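/- Let $n\ge 2$, let $D\subseteq\mathbb R^n$ be a domain, and let $f_j$, $j=1,2,\dots$, be homeomorphisms of $D$ into $\mathbb R^n$ (onto their images) of the class $W^{1,1}_{\mathrm{loc}}(D)$ that converge locally uniformly in $D$ to a mapping $f:D\to\mathbb R^n$. For a continuous map $g:D\to\mathbb R^n$ and $x\in D$ put $$K_g(x)=\frac{\|g'(x)\|^n}{|\det g'(x)|}\quad\text{if } \det g'(x)\ne 0,\qquad K_g(x)=1\quad\text{if } g'(x)=0,$$ and $K_g(x)=\infty$ at all other points of $D$, including the points where some first partial derivative of $g$ does not exist. Here $g'(x)$ is the matrix of first partial derivatives and $\|\cdot\|$ is the Euclidean operator norm. Put $P_g(x)=K_g(x)^{1/(n-1)}\in[1,\infty]$. Let $f$ be differentiable at $x_0\in D$, let $e_1,\dots,e_n$ be any orthonormal basis of eigenvectors of $f'(x_0)^*f'(x_0)$ (principal axes of the quadratic form $z\mapsto (f'(x_0)z,f'(x_0)z)$), and let $C(x_0,h)$ be the open cube centered at $x_0$ whose edges have length $h$ and are parallel to $e_1,\dots,e_n$. Then $$P_f(x_0)\le\liminf_{h\to0+}\ \liminf_{j\to\infty}\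 \frac1{h^n}\int_{C(x_0,h)}P_{f_j}(y)\,dm(y).$$ Moreover, for every continuous nondecreasing convex function $\Phi:[1,\infty]\to[0,\infty]$, $$\Phi(P_f(x_0))\le\liminf_{h\to0+}\ \liminf_{j\to\infty}\ \frac1{h^n}\int_{C(x_0,h)}\Phi(P_{f_j}(y))\,dm(y),$$ and $$K_f(x_0)\le\liminf_{h\to0+}\ \liminf_{j\to\infty}\ \frac1{h^n}\int_{C(x_0,h)}K_{f_j}(y)\,dm(y).$$ -/

import Mathlib

open Filter Topology MeasureTheory Set
open scoped ENNReal NNReal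

noncomputable section

/-- The `k`-th vector of the standard basis of `ℝⁿ`. -/
def stdVec {n : ℕ} (k : Fin n) : EuclideanSpace ℝ (Fin n) := EuclideanSpace.single k 1

/-- `v` is a distributional derivative of `u` in the `k`-th variable on the open set `U`:
`∫_U u ∂ₖφ = - ∫_U v φ` for all smooth `φ` with compact support in `U`. -/
def IsDistribDeriv {n : ℕ} (U : Set (EuclideanSpace ℝ (Fin n))) (k : Fin n)
    (u v : EuclideanSpace ℝ (Fin n) → ℝ) : Prop :=
  ∀ φ : EuclideanSpace ℝ (Fin n) → ℝ, ContDiff ℝ (⊤ : ℕ∞) φ → HasCompactSupport φ → tsupport φ ⊆ U →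
    ∫ x in U, u x * fderiv ℝ φ x (stdVec k) = - ∫ x in U, v x * φ x

/-- The Sobolev class `W^{1,1}(U)` of real functions. -/
def MemW11 {n : ℕ} (U : Set (EuclideanSpace ℝ (Fin n)))
    (u : EuclideanSpace ℝ (Fin n) → ℝ) : Prop :=
  IntegrableOn u U ∧ ∀ k : Fin n, ∃ v : EuclideanSpace ℝ (Fin n) → ℝ,
    IntegrableOn v U ∧ IsDistribDeriv U k u v

/-- The class `W^{1,1}_loc(D)` of maps into `ℝⁿ`, component by component. -/
def MemW11loc {n : ℕ} (D : Set (EuclideanSpace ℝ (Fin n)))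
    (f : EuclideanSpace ℝ (Fin n) → EuclideanSpace ℝ (Fin n)) : Prop :=
  ∀ i : Fin n, ∀ U : Set (EuclideanSpace ℝ (Fin n)),
    IsOpen U → IsCompact (closure U) → closure U ⊆ D → MemW11 U (fun x => f x i)

/-- `f` has all the first partial derivatives at `x`. -/
def HasPartials {n : ℕ} (f : EuclideanSpace ℝ (Fin n) → EuclideanSpace ℝ (Fin n))
    (x : EuclideanSpace ℝ (Fin n)) : Prop :=
  ∀ k : Fin n, LineDifferentiableAt ℝ f x (stdVec k)

/-- The Jacobian matrix `(∂ₖ fᵢ (x))` of first partial derivatives. -/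
def jacobianMatrix {n : ℕ} (f : EuclideanSpace ℝ (Fin n) → EuclideanSpace ℝ (Fin n))
    (x : EuclideanSpace ℝ (Fin n)) : Matrix (Fin n) (Fin n) ℝ :=
  Matrix.of fun i k => lineDeriv ℝ f x (stdVec k) i

open Classical in
/-- The outer dilatation `K_f(x)`: it is `‖f'(x)‖ⁿ / |J_f(x)|` (Euclidean operator norm) where
`J_f(x) ≠ 0`, it is `1` where `f'(x) = 0`, and `∞` at all other points, including those where
some first partial derivative does not exist. -/
def outerDil {n : ℕ} (f : EuclideanSpace ℝ (Fin n) → EuclideanSpace ℝ (Fin n))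
    (x : EuclideanSpace ℝ (Fin n)) : ℝ≥0∞ :=
  if HasPartials f x then
    if (jacobianMatrix f x).det ≠ 0 then
      ENNReal.ofReal
        (‖Matrix.toEuclideanCLM (𝕜 := ℝ) (jacobianMatrix f x)‖ ^ n / |(jacobianMatrix f x).det|)
    else if jacobianMatrix f x = 0 then 1 else ∞
  else ∞

/-- The dilatation `P_f = K_f^{1/(n-1)}`. -/
def dilP {n : ℕ} (f : EuclideanSpace ℝ (Fin n) → EuclideanSpace ℝ (Fin n))
    (x : EuclideanSpace ℝ (Fin n)) : ℝ≥0∞ :=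
  outerDil f x ^ (1 / ((n : ℝ) - 1))

/-- The orthonormal basis `e` consists of principal axes of the quadratic form `z ↦ (A z, A z)`,
that is, of eigenvectors of `A* A`. -/
def IsPrincipalAxes {n : ℕ} (A : EuclideanSpace ℝ (Fin n) →L[ℝ] EuclideanSpace ℝ (Fin n))
    (e : OrthonormalBasis (Fin n) ℝ (EuclideanSpace ℝ (Fin n))) : Prop :=
  ∀ i : Fin n, ∃ μ : ℝ, ContinuousLinearMap.adjoint A (A (e i)) = μ • e i

/-- The (open) cube with center `x₀` whose edges have length `h` and the directions `e i`. -/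
def cube {n : ℕ} (e : OrthonormalBasis (Fin n) ℝ (EuclideanSpace ℝ (Fin n)))
    (x₀ : EuclideanSpace ℝ (Fin n)) (h : ℝ) : Set (EuclideanSpace ℝ (Fin n)) :=
  {y | ∀ i : Fin n, |inner ℝ (e i) (y - x₀)| < h / 2}

/-- `liminf_{h → 0+} liminf_{j → ∞} h⁻ⁿ ∫_{C(x₀,h)} g_j(y) dm(y)` for functions
`g_j` with values in `[0, ∞]`. -/
def lowerCubeLimit {n : ℕ} (e : OrthonormalBasis (Fin n) ℝ (EuclideanSpace ℝ (Fin n)))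
    (x₀ : EuclideanSpace ℝ (Fin n)) (g : ℕ → EuclideanSpace ℝ (Fin n) → ℝ≥0∞) : ℝ≥0∞ :=
  liminf (fun h : ℝ =>
    liminf (fun j : ℕ => (∫⁻ y in cube e x₀ h, g j y) / ENNReal.ofReal (h ^ n)) atTop) (𝓝[>] 0)

end

/-! The argument is a length-volume comparison on small cubes. Let `A = f'(x₀)` be nonzero and let
`e i` be a principal axis with `‖A (e i)‖ = ‖A‖`. For small `h` and then large `j`, `F j` is within
`ε * h` of an affine map with linear part `A` on the cube. Three estimates for the weak derivative
`G` of `F j` combine.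

Length: segments parallel to `e i` are stretched by almost `‖A‖`, so the mean of `‖G‖` over the cube
is at least `‖A‖ (1 - ε) - 2ε` (`IsWeakDeriv.le_lintegral_cube`). Hölder: `‖G‖ⁿ = K |det G|` almost
everywhere where `K` is finite, and `K = P^(n-1)`, so `(∫ ‖G‖)ⁿ ≤ (∫ P)^(n-1) ∫ |det G|`
(`lintegral_enorm_pow_le`). Volume: `F j` is injective, so `∫ |det G|` is at most the volume of the
image of the cube (`IsWeakDeriv.lintegral_abs_det_le`), hence at most `hⁿ` times the volume of the
`ε`-neighbourhood of the image of the unit cube under `A`.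

Dividing by powers of `h` and letting `ε → 0` gives `(‖A‖ⁿ / |det A|)^(1/(n-1))` as a lower bound,
infinite if `det A = 0`. If `A = 0`, the claim is `P ≥ 1`.

The volume estimate uses neither classical differentiability almost everywhere nor Lusin's
condition: by Lebesgue points and Egorov's theorem, `u` is differentiable relative to sets of almost
full measure, where the area formula applies. Classical partials enter only through `K`; where they
exist they agree almost everywhere with the weak ones.

The inequality for `Φ` follows by Jensen's argument with affine minorants, and the one for `K` is
the case `Φ(t) = t^(n-1)`. -/

set_option linter.unusedSectionVars false

/-! ### Weak derivatives and integration along segments -/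

section WeakDerivative

variable {E : Type*} [NormedAddCommGroup E] [NormedSpace ℝ E] [FiniteDimensional ℝ E]
  [MeasurableSpace E] [BorelSpace E] {μ : Measure E} [μ.IsAddHaarMeasure]
  {F : Type*} [NormedAddCommGroup F] [NormedSpace ℝ F] [FiniteDimensional ℝ F]

/-- `G` is the weak (distributional) total derivative of `u` on `U`. -/
def IsWeakDeriv (μ : Measure E) (U : Set E) (u : E → F) (G : E → E →L[ℝ] F) : Prop :=
  ∀ φ : E → ℝ, ContDiff ℝ (⊤ : ℕ∞) φ → HasCompactSupport φ → tsupport φ ⊆ U →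
    ∀ v : E, ∫ x, (fderiv ℝ φ x v) • u x ∂μ = - ∫ x, φ x • G x v ∂μ

/-- The integral is the convolution of `u` with the reflected function `z ↦ φ (-z)` at `τ • v`; the
derivative falls on the smooth factor, so `u` need only be continuous. -/
theorem hasDerivAt_integral_translate_smul {φ : E → ℝ}
    (hφ : ContDiff ℝ (⊤ : ℕ∞) φ)
    (hc : HasCompactSupport φ) {u : E → F} (hu : Continuous u) (v : E) (τ : ℝ) :
    HasDerivAt (fun τ : ℝ => ∫ x, φ (x - τ • v) • u x ∂μ)
      (- ∫ x, (fderiv ℝ φ (x - τ • v) v) • u x ∂μ) τ := by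
  let g : E → ℝ := fun z => φ (-z)
  have hg : ContDiff ℝ 1 g := (hφ.of_le (by exact_mod_cast le_top)).comp contDiff_neg
  have hgc : HasCompactSupport g := hc.comp_homeomorph (Homeomorph.neg E)
  let L : F →L[ℝ] ℝ →L[ℝ] F := (ContinuousLinearMap.lsmul ℝ ℝ).flip
  have hul : LocallyIntegrable u μ := hu.locallyIntegrable
  have h1 := hgc.hasFDerivAt_convolution_right L hul hg (τ • v)
  have h2 : HasDerivAt (fun τ : ℝ => τ • v) v τ := by
    simpa using (hasDerivAt_id τ).smul_const v
  have h3 := h1.comp_hasDerivAt τ h2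
  rw [convolution_precompR_apply L hul (hgc.fderiv ℝ) (hg.continuous_fderiv one_ne_zero)] at h3
  have hfd : ∀ z, fderiv ℝ g z v = - fderiv ℝ φ (-z) v := by
    intro z
    have hd : HasFDerivAt φ (fderiv ℝ φ (-z)) (-z) :=
      (hφ.differentiable (by simp) _).hasFDerivAt
    have := (hd.comp z ((hasFDerivAt_id z).fun_neg)).fderiv
    rw [show g = φ ∘ fun z => -z from rfl, this]
    simp
  convert h3 using 1
  · ext τ
    simp [convolution_def, L, g]
  · rw [convolution_def, ← integral_neg]
    congr 1
    ext x
    simp [L, hfd]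

/-- All translates have the same `L¹` norm; this licenses Fubini along segments. -/
theorem integrable_translate_prod {g : E → F} (hg : Integrable g μ) (hm : StronglyMeasurable g)
    (v : E) :
    Integrable (fun p : E × ℝ => g (p.1 + p.2 • v)) (μ.prod (volume.restrict (Ioc 0 1))) := by
  have hsm : StronglyMeasurable (fun p : E × ℝ => g (p.1 + p.2 • v)) :=
    hm.comp_measurable (by fun_prop)
  rw [integrable_prod_iff' hsm.aestronglyMeasurable]
  refine ⟨Eventually.of_forall fun s => hg.comp_add_right (s • v), ?_⟩
  have : ∀ s : ℝ, ∫ x, ‖g (x + s • v)‖ ∂μ = ∫ x, ‖g x‖ ∂μ := fun s =>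
    integral_add_right_eq_self (fun x => ‖g x‖) (s • v)
  simp only [this]
  exact integrable_const _

/-- A continuous function is recovered from its weak derivative by integration along almost every
translate of a given segment. -/
theorem IsWeakDeriv.ae_sub_eq_integral {U V : Set E} (hV : IsOpen V) {u : E → F}
    {G : E → E →L[ℝ] F} (hw : IsWeakDeriv μ U u G) (hu : Continuous u) (hG : Integrable G μ)
    (hGm : StronglyMeasurable G) (v : E) (hVU : ∀ x ∈ V, ∀ s ∈ Icc (0 : ℝ) 1, x + s • v ∈ U) :
    ∀ᵐ x ∂μ, x ∈ V → u (x + v) - u x = ∫ s in (0 : ℝ)..1, G (x + s • v) v := by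
  have : CompleteSpace F := FiniteDimensional.complete ℝ F
  set g : E → F := fun x => G x v with hgdef
  have hgi : Integrable g μ := hG.apply_continuousLinearMap v
  have hgm : StronglyMeasurable g :=
    ((ContinuousLinearMap.apply ℝ F v).continuous.comp_stronglyMeasurable hGm)
  have hprod := integrable_translate_prod hgi hgm v
  have hIint : Integrable (fun x => ∫ s in (0 : ℝ)..1, g (x + s • v)) μ := by
    simp only [intervalIntegral.integral_of_le zero_le_one]
    exact hprod.integral_prod_left
  have key := hV.ae_eq_zero_of_integral_contDiff_smul_eq_zero (μ := μ)
    (f := fun x => (u (x + v) - u x) - ∫ s in (0 : ℝ)..1, g (x + s • v)) ?_ ?_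
  · filter_upwards [key] with x hx hxV
    exact sub_eq_zero.1 (hx hxV)
  · refine LocallyIntegrable.locallyIntegrableOn ?_ V
    exact (((hu.comp (continuous_add_const v)).sub hu).locallyIntegrable).sub
      hIint.locallyIntegrable
  intro φ hφ hc hsupp
  have hφc : Continuous φ := hφ.continuous
  obtain ⟨M, hM⟩ := hφc.bounded_above_of_compact_support hc
  have ht : ∀ s : ℝ, ∫ x, φ (x - s • v) • g x ∂μ = ∫ x, φ x • g (x + s • v) ∂μ := by
    intro s
    rw [← integral_add_right_eq_self _ (s • v)]
    simp
  -- The translate of `φ` by `s • v` is still supported in `U`, so the weak derivative identity may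
  -- be tested with it. Integrating over `s` and swapping integrals then gives the claim tested
  -- against `φ`.
  have hder : ∀ s ∈ uIcc (0 : ℝ) 1,
      HasDerivAt (fun τ : ℝ => ∫ x, φ (x - τ • v) • u x ∂μ) (∫ x, φ x • g (x + s • v) ∂μ) s := by
    intro s hs
    rw [uIcc_of_le zero_le_one] at hs
    have h1 := hasDerivAt_integral_translate_smul (μ := μ) hφ hc hu v s
    have h2 := hw (fun x => φ (x - s • v)) (hφ.comp (contDiff_id.sub contDiff_const))
      (hc.comp_homeomorph (Homeomorph.subRight (s • v))) ?_ v
    · have h3 : ∀ x, fderiv ℝ (fun x => φ (x - s • v)) x = fderiv ℝ φ (x - s • v) := fun x =>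
        by simpa [sub_eq_add_neg] using fderiv_comp_add_right (f := φ) (x := x) (-(s • v))
      simp only [h3] at h2
      rw [h2, neg_neg] at h1
      rw [← ht s]
      exact h1
    · intro x hx
      have : x - s • v ∈ tsupport φ :=
        tsupport_comp_subset_preimage φ (f := fun x => x - s • v) (by fun_prop) hx
      simpa using hVU _ (hsupp this) s hs
  have hprod2 : Integrable (fun p : E × ℝ => φ p.1 • g (p.1 + p.2 • v))
      (μ.prod (volume.restrict (Ioc 0 1))) := by
    refine hprod.bdd_smul M ?_ (Eventually.of_forall fun p => hM p.1)
    exact (hφc.comp continuous_fst).aestronglyMeasurable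
  have hFTC := intervalIntegral.integral_eq_sub_of_hasDerivAt hder (by
    rw [intervalIntegrable_iff_integrableOn_Ioc_of_le zero_le_one]
    exact hprod2.integral_prod_right)
  rw [intervalIntegral.integral_of_le zero_le_one, ← integral_integral_swap (f := fun x s => φ x • g (x + s • v)) hprod2] at hFTC
  have hi1 : Integrable (fun x => φ x • u x) μ :=
    (hφc.smul hu).integrable_of_hasCompactSupport hc.smul_right
  have hi2 : Integrable (fun x => φ x • u (x + v)) μ :=
    (hφc.smul (hu.comp (continuous_add_const v))).integrable_of_hasCompactSupport hc.smul_right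
  have h5 : ∫ x, φ (x - (1 : ℝ) • v) • u x ∂μ = ∫ x, φ x • u (x + v) ∂μ := by
    rw [← integral_add_right_eq_self _ v]
    simp
  rw [h5] at hFTC
  simp only [zero_smul, sub_zero] at hFTC
  have hi3 : Integrable (fun x => φ x • ∫ s in (0 : ℝ)..1, g (x + s • v)) μ := by
    refine hIint.bdd_smul M hφc.aestronglyMeasurable (Eventually.of_forall fun p => hM p)
  simp only [smul_sub]
  have hi4 : Integrable (fun x => φ x • u (x + v) - φ x • u x) μ := hi2.sub hi1
  rw [integral_sub hi4 hi3, integral_sub hi2 hi1, ← hFTC]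
  simp only [intervalIntegral.integral_of_le zero_le_one, integral_smul, sub_self]

end WeakDerivative

/-! ### Difference quotients and mean stretching -/

section WeakDerivativeEstimates

variable {E : Type*} [NormedAddCommGroup E] [NormedSpace ℝ E] [FiniteDimensional ℝ E]
  [MeasurableSpace E] [BorelSpace E] {μ : Measure E} [μ.IsAddHaarMeasure]
  {F : Type*} [NormedAddCommGroup F] [NormedSpace ℝ F] [FiniteDimensional ℝ F]

/-- Translation is continuous in `L¹`. -/
theorem tendsto_lintegral_enorm_translate_sub {g : E → F} (hg : Integrable g μ) :
    Tendsto (fun y => ∫⁻ x, ‖g (x + y) - g x‖ₑ ∂μ) (𝓝 0) (𝓝 0) := by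
  have hg1 : MemLp g 1 μ := memLp_one_iff_integrable.2 hg
  let T : C(E, C(E, E)) := ContinuousMap.curry ⟨fun p : E × E => p.2 + p.1, by fun_prop⟩
  have hT : ∀ y, MeasurePreserving (T y) μ μ := fun y => measurePreserving_add_right μ y
  let gL : Lp F 1 μ := hg1.toLp g
  have hcont : Continuous fun y => Lp.compMeasurePreserving (T y) (hT y) gL :=
    (continuous_const (y := gL)).compMeasurePreservingLp T.continuous hT (by simp)
  have h0 : Tendsto (fun y => edist (Lp.compMeasurePreserving (T y) (hT y) gL)
      (Lp.compMeasurePreserving (T 0) (hT 0) gL)) (𝓝 0) (𝓝 0) := by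
    have := (hcont.tendsto 0).edist (tendsto_const_nhds
      (x := Lp.compMeasurePreserving (T 0) (hT 0) gL))
    simpa using this
  refine h0.congr fun y => ?_
  rw [Lp.toLp_compMeasurePreserving hg1, Lp.toLp_compMeasurePreserving hg1, Lp.edist_toLp_toLp,
    eLpNorm_one_eq_lintegral_enorm]
  refine lintegral_congr fun x => ?_
  simp [T]

/-- The quantifier over `L` stands inside `∀ᵐ`: the null set does not depend on `L`, so `L = G x` is
allowed. -/
theorem IsWeakDeriv.ae_enorm_sub_le {U V : Set E} (hV : IsOpen V) {u : E → F}
    {G : E → E →L[ℝ] F} (hw : IsWeakDeriv μ U u G) (hu : Continuous u) (hG : Integrable G μ)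
    (hGm : StronglyMeasurable G) (v : E) (hVU : ∀ x ∈ V, ∀ s ∈ Icc (0 : ℝ) 1, x + s • v ∈ U) :
    ∀ᵐ x ∂μ, x ∈ V → ∀ L : E →L[ℝ] F,
      ‖u (x + v) - u x - L v‖ₑ ≤ ∫⁻ s in Ioc (0 : ℝ) 1, ‖G (x + s • v) v - L v‖ₑ := by
  have : CompleteSpace F := FiniteDimensional.complete ℝ F
  have hgi : Integrable (fun x => G x v) μ := hG.apply_continuousLinearMap v
  have hgm : StronglyMeasurable (fun x => G x v) :=
    ((ContinuousLinearMap.apply ℝ F v).continuous.comp_stronglyMeasurable hGm)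
  filter_upwards [hw.ae_sub_eq_integral hV hu hG hGm v hVU,
    (integrable_translate_prod hgi hgm v).prod_right_ae] with x hx hxi hxV L
  have : u (x + v) - u x - L v = ∫ s in Ioc (0 : ℝ) 1, (G (x + s • v) v - L v) := by
    rw [hx hxV, integral_sub hxi (integrable_const _),
      intervalIntegral.integral_of_le zero_le_one]
    simp
  rw [this]
  exact enorm_integral_le_lintegral_enorm _

/-- The right side is an average of `L¹` translation moduli of `G`, so the difference quotients
converge to `G · v` in `L¹` as `t → 0`. -/
theorem IsWeakDeriv.lintegral_enorm_sub_le {U V : Set E} (hV : IsOpen V) {u : E → F}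
    {G : E → E →L[ℝ] F} (hw : IsWeakDeriv μ U u G) (hu : Continuous u) (hG : Integrable G μ)
    (hGm : StronglyMeasurable G) (v : E) (t : ℝ) (ht : t ≠ 0)
    (hVU : ∀ x ∈ V, ∀ s ∈ Icc (0 : ℝ) 1, x + s • (t • v) ∈ U) :
    ∫⁻ x in V, ‖t⁻¹ • (u (x + t • v) - u x) - G x v‖ₑ ∂μ ≤
      ∫⁻ s in Ioc (0 : ℝ) 1, ∫⁻ x, ‖G (x + s • (t • v)) v - G x v‖ₑ ∂μ := by
  have hgm : StronglyMeasurable (fun x => G x v) :=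
    ((ContinuousLinearMap.apply ℝ F v).continuous.comp_stronglyMeasurable hGm)
  have hm : Measurable (fun p : E × ℝ => ‖G (p.1 + p.2 • (t • v)) v - G p.1 v‖ₑ) :=
    ((hgm.comp_measurable (g := fun p : E × ℝ => p.1 + p.2 • (t • v)) (by fun_prop)).sub
      (hgm.comp_measurable measurable_fst)).enorm
  calc ∫⁻ x in V, ‖t⁻¹ • (u (x + t • v) - u x) - G x v‖ₑ ∂μ
      ≤ ∫⁻ x in V, (∫⁻ s in Ioc (0 : ℝ) 1, ‖G (x + s • (t • v)) v - G x v‖ₑ) ∂μ := by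
        refine lintegral_mono_ae ((ae_restrict_iff' hV.measurableSet).2 ?_)
        filter_upwards [hw.ae_enorm_sub_le hV hu hG hGm (t • v) hVU] with x hx hxV
        have h1 := hx hxV (G x)
        have h2 : t⁻¹ • (u (x + t • v) - u x) - G x v
            = t⁻¹ • (u (x + t • v) - u x - G x (t • v)) := by
          rw [smul_sub t⁻¹ _ (G x (t • v)), map_smul, smul_smul, inv_mul_cancel₀ ht, one_smul]
        rw [h2, enorm_smul]
        calc _ ≤ ‖t⁻¹‖ₑ * ∫⁻ s in Ioc (0 : ℝ) 1,
                ‖G (x + s • (t • v)) (t • v) - G x (t • v)‖ₑ := by gcongr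
          _ = ‖t⁻¹‖ₑ * ∫⁻ s in Ioc (0 : ℝ) 1,
                ‖t‖ₑ * ‖G (x + s • (t • v)) v - G x v‖ₑ := by
              simp only [map_smul, ← smul_sub, enorm_smul]
          _ = _ := by
              rw [lintegral_const_mul' _ _ enorm_ne_top, ← mul_assoc, ← enorm_mul,
                inv_mul_cancel₀ ht]
              simp
    _ ≤ ∫⁻ x, (∫⁻ s in Ioc (0 : ℝ) 1, ‖G (x + s • (t • v)) v - G x v‖ₑ) ∂μ :=
        setLIntegral_le_lintegral _ _
    _ = _ := lintegral_lintegral_swap hm.aemeasurable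

/-- Classical directional derivatives coincide with weak ones almost everywhere where they exist. -/
theorem IsWeakDeriv.ae_lineDeriv_eq {U V : Set E} (hV : IsOpen V) {u : E → F}
    {G : E → E →L[ℝ] F} (hw : IsWeakDeriv μ U u G) (hu : Continuous u) (hG : Integrable G μ)
    (hGm : StronglyMeasurable G) {ρ : ℝ} (hρ : 0 < ρ) (hVU : ∀ x ∈ V, Metric.ball x ρ ⊆ U) (v : E) :
    ∀ᵐ x ∂μ, x ∈ V → LineDifferentiableAt ℝ u x v → lineDeriv ℝ u x v = G x v := by
  have hgi : Integrable (fun x => G x v) μ := hG.apply_continuousLinearMap v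
  have hgm : StronglyMeasurable (fun x => G x v) :=
    ((ContinuousLinearMap.apply ℝ F v).continuous.comp_stronglyMeasurable hGm)
  -- Steps tending to zero with `‖t k • v‖ < ρ`, so that segments starting in `V` stay in `U`; the
  -- `+ 1` covers `v = 0`.
  let t : ℕ → ℝ := fun k => ρ / (‖v‖ + 1) / (k + 1)
  have htpos : ∀ k, 0 < t k := fun k => by positivity
  have ht0 : Tendsto t atTop (𝓝 0) := by
    simpa [t, div_eq_mul_inv] using
      (tendsto_one_div_add_atTop_nhds_zero_nat (𝕜 := ℝ)).const_mul (ρ / (‖v‖ + 1))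
  have htv : ∀ k, ‖t k • v‖ < ρ := by
    intro k
    rw [norm_smul, Real.norm_of_nonneg (htpos k).le]
    have h1 : t k ≤ ρ / (‖v‖ + 1) := div_le_self (by positivity) (by simp)
    calc t k * ‖v‖ ≤ ρ / (‖v‖ + 1) * ‖v‖ := by gcongr
      _ < ρ / (‖v‖ + 1) * (‖v‖ + 1) := by
          have : 0 < ρ / (‖v‖ + 1) := by positivity
          nlinarith
      _ = ρ := by field_simp
  have hseg : ∀ k, ∀ x ∈ V, ∀ s ∈ Icc (0 : ℝ) 1, x + s • (t k • v) ∈ U := by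
    intro k x hx s hs
    apply hVU x hx
    rw [mem_ball_iff_norm, add_sub_cancel_left, norm_smul, Real.norm_of_nonneg hs.1]
    exact (mul_le_of_le_one_left (norm_nonneg _) hs.2).trans_lt (htv k)
  set q : ℕ → E → F := fun k x => (t k)⁻¹ • (u (x + t k • v) - u x) - G x v with hq
  have hqm : ∀ k, Measurable fun x => ‖q k x‖ₑ := fun k =>
    ((((hu.comp (continuous_add_const _)).sub hu).const_smul _).stronglyMeasurable.sub hgm).enorm
  have hlim : Tendsto (fun k => ∫⁻ x in V, ‖q k x‖ₑ ∂μ) atTop (𝓝 0) := by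
    rw [ENNReal.tendsto_nhds_zero]
    intro ε hε
    have htr := ENNReal.tendsto_nhds_zero.1 (tendsto_lintegral_enorm_translate_sub hgi) ε hε
    obtain ⟨δ, hδ, hδε⟩ := Metric.eventually_nhds_iff.1 htr
    have hts : Tendsto (fun k => ‖t k • v‖) atTop (𝓝 0) := by
      simpa using (ht0.smul_const v).norm
    filter_upwards [hts.eventually (gt_mem_nhds hδ)] with k hk
    refine (hw.lintegral_enorm_sub_le hV hu hG hGm v (t k) (htpos k).ne' (hseg k)).trans ?_
    calc _ ≤ ∫⁻ s in Ioc (0 : ℝ) 1, ε := by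
          refine setLIntegral_mono measurable_const fun s hs => hδε ?_
          rw [dist_zero_right, norm_smul, Real.norm_of_nonneg hs.1.le]
          exact (mul_le_of_le_one_left (norm_nonneg _) hs.2).trans_lt hk
      _ = ε := by simp
  -- Fatou replaces the passage to an almost everywhere convergent subsequence: where the line
  -- derivative exists, the liminf is a limit.
  have hfatou : ∫⁻ x in V, liminf (fun k => ‖q k x‖ₑ) atTop ∂μ = 0 := by
    refine le_antisymm ((lintegral_liminf_le hqm).trans ?_) zero_le
    rw [hlim.liminf_eq]
  rw [lintegral_eq_zero_iff (Measurable.liminf hqm)] at hfatou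
  filter_upwards [(ae_restrict_iff' hV.measurableSet).1 hfatou] with x hx hxV hdiff
  have h1 : Tendsto (fun k => ‖q k x‖ₑ) atTop (𝓝 ‖lineDeriv ℝ u x v - G x v‖ₑ) := by
    have h2 := hdiff.hasLineDerivAt
    rw [HasLineDerivAt, hasDerivAt_iff_tendsto_slope_zero] at h2
    have h3 : Tendsto t atTop (𝓝[≠] 0) :=
      tendsto_nhdsWithin_iff.2 ⟨ht0, Eventually.of_forall fun k => (htpos k).ne'⟩
    have h4 := h2.comp h3
    simp only [Function.comp_def, zero_add, zero_smul, add_zero] at h4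
    exact (h4.sub_const _).enorm
  have h5 := hx hxV
  rw [h1.liminf_eq] at h5
  simpa [sub_eq_zero] using h5

/-- If `u` oscillates by at least `c` along all translates `[x, x + v]`, `x ∈ S`, of a segment,
and each point of `C` lies on a portion of at most `θ` of them, then the derivative of `u` along
`v` is large in the mean on `C`. -/
theorem IsWeakDeriv.mul_measure_le_lintegral {U S C : Set E} (hS : IsOpen S)
    (hC : MeasurableSet C) (hCU : C ⊆ U) {u : E → F}
    {G : E → E →L[ℝ] F} (hw : IsWeakDeriv μ U u G) (hu : Continuous u) (hG : Integrable G μ)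
    (hGm : StronglyMeasurable G) (v : E) (hSC : ∀ x ∈ S, ∀ s ∈ Icc (0 : ℝ) 1, x + s • v ∈ C)
    {c θ : ℝ≥0∞} (hc : ∀ x ∈ S, c ≤ ‖u (x + v) - u x‖ₑ)
    (hθ : ∀ y ∈ C, volume {s : ℝ | y - s • v ∈ S} ≤ θ) :
    c * μ S ≤ θ * ∫⁻ y in C, ‖G y v‖ₑ ∂μ := by
  have hgm : Measurable (fun x => ‖G x v‖ₑ) :=
    ((ContinuousLinearMap.apply ℝ F v).continuous.comp_stronglyMeasurable hGm).enorm
  have hm : Measurable (Function.uncurry fun (x : E) (s : ℝ) =>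
      S.indicator (fun _ => ‖G (x + s • v) v‖ₑ) x) := by
    have h1 : Measurable (fun p : E × ℝ => ‖G (p.1 + p.2 • v) v‖ₑ) :=
      hgm.comp (g := fun x => ‖G x v‖ₑ) (f := fun p : E × ℝ => p.1 + p.2 • v) (by fun_prop)
    exact h1.indicator (measurable_fst hS.measurableSet)
  have hm2 : Measurable (Function.uncurry fun (s : ℝ) (y : E) =>
      S.indicator (fun _ => ‖G y v‖ₑ) (y - s • v)) := by
    have h1 : Measurable (fun p : ℝ × E => ‖G p.2 v‖ₑ) := hgm.comp measurable_snd
    have h2 : Measurable (fun p : ℝ × E => p.2 - p.1 • v) := by fun_prop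
    exact h1.indicator (h2 hS.measurableSet)
  calc c * μ S = ∫⁻ x in S, c ∂μ := by simp
    _ ≤ ∫⁻ x in S, (∫⁻ s in Ioc (0 : ℝ) 1, ‖G (x + s • v) v‖ₑ) ∂μ := by
        refine lintegral_mono_ae ((ae_restrict_iff' hS.measurableSet).2 ?_)
        filter_upwards [hw.ae_enorm_sub_le hS hu hG hGm v
          fun x hx s hs => hCU (hSC x hx s hs)] with x hx hxS
        simpa using (hc x hxS).trans (by simpa using hx hxS 0)
    _ = ∫⁻ x, (∫⁻ s in Ioc (0 : ℝ) 1, S.indicator (fun _ => ‖G (x + s • v) v‖ₑ) x) ∂μ := by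
        rw [← lintegral_indicator hS.measurableSet]
        refine lintegral_congr fun x => ?_
        by_cases hx : x ∈ S <;> simp [hx]
    _ = ∫⁻ s in Ioc (0 : ℝ) 1, ∫⁻ x, S.indicator (fun _ => ‖G (x + s • v) v‖ₑ) x ∂μ :=
        lintegral_lintegral_swap hm.aemeasurable
    _ = ∫⁻ s in Ioc (0 : ℝ) 1, ∫⁻ y, S.indicator (fun _ => ‖G y v‖ₑ) (y - s • v) ∂μ := by
        refine lintegral_congr fun s => ?_
        rw [← lintegral_add_right_eq_self
          (fun y => S.indicator (fun _ => ‖G y v‖ₑ) (y - s • v)) (s • v)]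
        refine lintegral_congr fun x => ?_
        rw [add_sub_cancel_right]
    _ = ∫⁻ y, (∫⁻ s in Ioc (0 : ℝ) 1, S.indicator (fun _ => ‖G y v‖ₑ) (y - s • v)) ∂μ :=
        lintegral_lintegral_swap hm2.aemeasurable
    -- After the substitution `y = x + s • v`, each `y` is counted with the length of the set of `s`
    -- with `y - s • v ∈ S`, at most `θ`; points outside `C` are never reached.
    _ ≤ ∫⁻ y, C.indicator (fun y => θ * ‖G y v‖ₑ) y ∂μ := by
        refine lintegral_mono fun y => ?_
        by_cases hy : y ∈ C
        · have hmS : MeasurableSet {s : ℝ | y - s • v ∈ S} :=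
            (show Measurable fun s : ℝ => y - s • v by fun_prop) hS.measurableSet
          have : (fun s : ℝ => S.indicator (fun _ => ‖G y v‖ₑ) (y - s • v)) =
              {s : ℝ | y - s • v ∈ S}.indicator fun _ => ‖G y v‖ₑ := by
            ext s; simp [indicator]
          rw [this, lintegral_indicator hmS, lintegral_const, indicator_of_mem hy, mul_comm]
          gcongr
          rw [Measure.restrict_apply_univ]
          exact (Measure.restrict_apply_le _ _).trans (hθ y hy)
        · rw [indicator_of_notMem hy]
          refine (setLIntegral_congr_fun measurableSet_Ioc (g := fun _ => 0)
            fun s hs => indicator_of_notMem (fun h => hy ?_) _).trans_le (by simp)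
          simpa using hSC _ h s ⟨hs.1.le, hs.2⟩
    _ = θ * ∫⁻ y in C, ‖G y v‖ₑ ∂μ := by
        rw [lintegral_indicator hC, lintegral_const_mul _ hgm]

end WeakDerivativeEstimates

/-! ### Differentiability in the mean -/

section ApproximateDifferentiability

open Metric Module

variable {E : Type*} [NormedAddCommGroup E] [NormedSpace ℝ E] [FiniteDimensional ℝ E]
  [MeasurableSpace E] [BorelSpace E] {μ : Measure E} [μ.IsAddHaarMeasure]
  {F : Type*} [NormedAddCommGroup F] [NormedSpace ℝ F] [FiniteDimensional ℝ F]

/-- Integral and ball volume scale by the same power of `s`, so smallness of means at all radii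
below `r` becomes a bound at radius `r` uniform in `s`. -/
theorem lintegral_closedBall_dilation_le {h : E → ℝ≥0∞} (hh : Measurable h) {x : E} {s r : ℝ}
    (hs : 0 < s) (hr : 0 < r) {η : ℝ≥0∞}
    (H : ∫⁻ y in closedBall x (s * r), h y ∂μ ≤ η * μ (closedBall x (s * r))) :
    ∫⁻ v in closedBall 0 r, h (x + s • v) ∂μ ≤ η * μ (closedBall 0 r) := by
  have hsn : 0 < s ^ finrank ℝ E := pow_pos hs _
  have hind : Measurable ((closedBall x (s * r)).indicator h) :=
    hh.indicator measurableSet_closedBall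
  have e1 : ∫⁻ v in closedBall 0 r, h (x + s • v) ∂μ =
      ∫⁻ v, (closedBall x (s * r)).indicator h (x + s • v) ∂μ := by
    rw [← lintegral_indicator measurableSet_closedBall]
    refine lintegral_congr fun v => ?_
    have : x + s • v ∈ closedBall x (s * r) ↔ v ∈ closedBall (0 : E) r := by
      rw [mem_closedBall_iff_norm, mem_closedBall_zero_iff, add_sub_cancel_left, norm_smul,
        Real.norm_of_nonneg hs.le, mul_le_mul_iff_right₀ hs]
    by_cases hv : v ∈ closedBall (0 : E) r
    · rw [indicator_of_mem hv, indicator_of_mem (this.2 hv)]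
    · rw [indicator_of_notMem hv, indicator_of_notMem (fun h => hv (this.1 h))]
  have e2 : ∫⁻ v, (closedBall x (s * r)).indicator h (x + s • v) ∂μ =
      ENNReal.ofReal |(s ^ finrank ℝ E)⁻¹| * ∫⁻ y in closedBall x (s * r), h y ∂μ := by
    have := lintegral_map (μ := μ) (f := fun w => (closedBall x (s * r)).indicator h (x + w))
      (g := fun v => s • v) (hind.comp (measurable_const_add x)) (measurable_const_smul s)
    rw [← this, Measure.map_addHaar_smul μ hs.ne', lintegral_smul_measure,
      lintegral_add_left_eq_self, lintegral_indicator measurableSet_closedBall, smul_eq_mul]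
  rw [e1, e2]
  calc _ ≤ ENNReal.ofReal |(s ^ finrank ℝ E)⁻¹| * (η * μ (closedBall x (s * r))) := by gcongr
    _ = (ENNReal.ofReal |(s ^ finrank ℝ E)⁻¹| * ENNReal.ofReal (s ^ finrank ℝ E)) *
        (η * μ (closedBall 0 r)) := by
      rw [Measure.addHaar_closedBall_mul μ x hs.le hr.le]; ring
    _ = _ := by
      rw [← ENNReal.ofReal_mul (abs_nonneg _), abs_of_pos (inv_pos.2 hsn),
        inv_mul_cancel₀ hsn.ne']
      simp

/-- The defect at `v` of the first order expansion of `u` at `x` with derivative `G x`, plus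
`r` times the oscillation of `G`. -/
noncomputable def taylorDefect (u : E → F) (G : E → E →L[ℝ] F) (r : ℝ) (x v : E) : ℝ≥0∞ :=
  ‖u (x + v) - u x - G x v‖ₑ + ENNReal.ofReal r * ‖G (x + v) - G x‖ₑ

theorem measurable_taylorDefect {u : E → F} {G : E → E →L[ℝ] F} (hu : Continuous u)
    (hGm : StronglyMeasurable G) (r : ℝ) :
    Measurable (Function.uncurry (taylorDefect u G r)) := by
  have h1 : StronglyMeasurable fun p : E × E => u (p.1 + p.2) - u p.1 :=
    ((hu.comp (continuous_fst.add continuous_snd)).sub (hu.comp continuous_fst)).stronglyMeasurable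
  have h2 : StronglyMeasurable fun p : E × E => G p.1 p.2 :=
    (isBoundedBilinearMap_apply (𝕜 := ℝ) (E := E) (F := F)).continuous.comp_stronglyMeasurable
      (f := fun p : E × E => (G p.1, p.2))
      ((hGm.comp_measurable measurable_fst).prodMk measurable_snd.stronglyMeasurable)
  have h3 : StronglyMeasurable fun p : E × E => G (p.1 + p.2) - G p.1 :=
    (hGm.comp_measurable (g := fun p : E × E => p.1 + p.2) (by fun_prop)).sub
      (hGm.comp_measurable measurable_fst)
  exact (h1.sub h2).enorm.add (h3.enorm.const_mul _)

/-- A continuous map with a weak derivative is, in the mean, differentiable at almost every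
point. -/
theorem IsWeakDeriv.ae_eventually_lintegral_taylorDefect_le {U V : Set E} (hV : IsOpen V)
    {u : E → F} {G : E → E →L[ℝ] F} (hw : IsWeakDeriv μ U u G) (hu : Continuous u)
    (hG : Integrable G μ) (hGm : StronglyMeasurable G) {ρ : ℝ} (hρ : 0 < ρ)
    (hVU : ∀ x ∈ V, Metric.ball x ρ ⊆ U) :
    ∀ᵐ x ∂μ, x ∈ V → ∀ η : ℝ≥0∞, η ≠ 0 → ∀ᶠ r in 𝓝[>] (0 : ℝ),
      ∫⁻ v in closedBall 0 r, taylorDefect u G r x v ∂μ ≤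
        η * (ENNReal.ofReal r * μ (closedBall 0 r)) := by
  have hm : MeasurableSet {p : E × E | p.1 ∈ V → p.2 ∈ ball (0 : E) ρ →
      ‖u (p.1 + p.2) - u p.1 - G p.1 p.2‖ₑ ≤
        ∫⁻ s in Ioc (0 : ℝ) 1, ‖G (p.1 + s • p.2) p.2 - G p.1 p.2‖ₑ} := by
    have h1 : Measurable fun p : E × E => ‖u (p.1 + p.2) - u p.1 - G p.1 p.2‖ₑ := by
      simpa [Function.uncurry_def, taylorDefect] using measurable_taylorDefect hu hGm 0
    have h2 : Measurable fun q : (E × E) × ℝ =>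
        ‖G (q.1.1 + q.2 • q.1.2) q.1.2 - G q.1.1 q.1.2‖ₑ := by
      have hb := (isBoundedBilinearMap_apply (𝕜 := ℝ) (E := E) (F := F)).continuous
      have a1 : StronglyMeasurable fun q : (E × E) × ℝ => G (q.1.1 + q.2 • q.1.2) q.1.2 :=
        hb.comp_stronglyMeasurable (f := fun q : (E × E) × ℝ => (G (q.1.1 + q.2 • q.1.2), q.1.2))
          ((hGm.comp_measurable (g := fun q : (E × E) × ℝ => q.1.1 + q.2 • q.1.2)
            (by fun_prop)).prodMk (measurable_snd.comp measurable_fst).stronglyMeasurable)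
      have a2 : StronglyMeasurable fun q : (E × E) × ℝ => G q.1.1 q.1.2 :=
        hb.comp_stronglyMeasurable (f := fun q : (E × E) × ℝ => (G q.1.1, q.1.2))
          ((hGm.comp_measurable (measurable_fst.comp measurable_fst)).prodMk
            (measurable_snd.comp measurable_fst).stronglyMeasurable)
      exact (a1.sub a2).enorm
    have h3 := measurableSet_le h1 (h2.lintegral_prod_right' (ν := volume.restrict (Ioc (0 : ℝ) 1)))
    have h4 : MeasurableSet {p : E × E | p.1 ∈ V} := measurable_fst hV.measurableSet
    have h5 : MeasurableSet {p : E × E | p.2 ∈ ball (0 : E) ρ} :=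
      measurable_snd measurableSet_ball
    exact h4.imp (h5.imp h3)
  -- For each `v` the estimate holds for almost every `x`; Fubini turns this into almost every `v`
  -- for almost every fixed `x`.
  have hfub : ∀ᵐ x ∂μ, ∀ᵐ v ∂μ, x ∈ V → v ∈ ball (0 : E) ρ → ‖u (x + v) - u x - G x v‖ₑ ≤
      ∫⁻ s in Ioc (0 : ℝ) 1, ‖G (x + s • v) v - G x v‖ₑ := by
    rw [Measure.ae_ae_comm hm]
    refine Eventually.of_forall fun v => ?_
    by_cases hv : v ∈ ball (0 : E) ρ
    · have hseg : ∀ x ∈ V, ∀ s ∈ Icc (0 : ℝ) 1, x + s • v ∈ U := by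
        intro x hx s hs
        apply hVU x hx
        rw [mem_ball_iff_norm, add_sub_cancel_left, norm_smul, Real.norm_of_nonneg hs.1]
        exact (mul_le_of_le_one_left (norm_nonneg _) hs.2).trans_lt (by simpa using hv)
      filter_upwards [hw.ae_enorm_sub_le hV hu hG hGm v hseg] with x hx hxV _ using hx hxV (G x)
    · exact Eventually.of_forall fun x _ h => absurd h hv
  have hLeb := (Besicovitch.vitaliFamily μ).ae_tendsto_lintegral_enorm_sub_div hG.locallyIntegrable
  filter_upwards [hfub, hLeb] with x hx hxL hxV η hη
  have hη2 : η / 2 ≠ 0 := by simp [hη]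
  have hx0 := ENNReal.tendsto_nhds_zero.1 (hxL.comp (Besicovitch.tendsto_filterAt μ x)) (η / 2)
    (pos_iff_ne_zero.2 hη2)
  obtain ⟨r₀, hr₀, hr₀η⟩ := mem_nhdsGT_iff_exists_Ioo_subset.1 hx0
  have hr₀' : (0 : ℝ) < r₀ := hr₀
  have hbound : ∀ t, 0 < t → t < r₀ →
      ∫⁻ y in closedBall x t, ‖G y - G x‖ₑ ∂μ ≤ η / 2 * μ (closedBall x t) := by
    intro t ht0 ht
    have h : (∫⁻ y in closedBall x t, ‖G y - G x‖ₑ ∂μ) / μ (closedBall x t) ≤ η / 2 :=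
      hr₀η ⟨ht0, ht⟩
    rwa [ENNReal.div_le_iff (measure_closedBall_pos μ x ht0).ne' measure_closedBall_lt_top.ne] at h
  have hGx : Measurable fun y => ‖G y - G x‖ₑ := (hGm.sub stronglyMeasurable_const).enorm
  filter_upwards [Ioo_mem_nhdsGT (lt_min hr₀' hρ)] with r hr
  have hr0 : 0 < r := hr.1
  have hrr₀ : r < r₀ := hr.2.trans_le (min_le_left _ _)
  have hrρ : r < ρ := hr.2.trans_le (min_le_right _ _)
  have hdil : ∀ s ∈ Ioc (0 : ℝ) 1,
      ∫⁻ v in closedBall 0 r, ‖G (x + s • v) - G x‖ₑ ∂μ ≤ η / 2 * μ (closedBall 0 r) := by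
    intro s hs
    refine lintegral_closedBall_dilation_le hGx hs.1 hr0 (hbound _ (mul_pos hs.1 hr0) ?_)
    exact (mul_le_of_le_one_left hr0.le hs.2).trans_lt hrr₀
  have hmeas2 : Measurable (Function.uncurry fun (v : E) (s : ℝ) => ‖G (x + s • v) - G x‖ₑ) :=
    hGx.comp (g := fun y => ‖G y - G x‖ₑ) (f := fun p : E × ℝ => x + p.2 • p.1) (by fun_prop)
  have hfirst : ∫⁻ v in closedBall 0 r, ‖u (x + v) - u x - G x v‖ₑ ∂μ ≤
      η / 2 * (ENNReal.ofReal r * μ (closedBall 0 r)) := by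
    calc ∫⁻ v in closedBall 0 r, ‖u (x + v) - u x - G x v‖ₑ ∂μ
        ≤ ∫⁻ v in closedBall 0 r, ENNReal.ofReal r *
            (∫⁻ s in Ioc (0 : ℝ) 1, ‖G (x + s • v) - G x‖ₑ) ∂μ := by
          refine lintegral_mono_ae ((ae_restrict_iff' measurableSet_closedBall).2 ?_)
          filter_upwards [hx] with v hv hvr
          have hvr' : ‖v‖ ≤ r := by simpa using hvr
          refine (hv hxV (by simpa using hvr'.trans_lt hrρ)).trans ?_
          rw [← lintegral_const_mul' _ _ ENNReal.ofReal_ne_top]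
          refine lintegral_mono fun s => ?_
          rw [← sub_apply, mul_comm]
          refine (ContinuousLinearMap.le_opENorm _ _).trans ?_
          gcongr
          rw [← ofReal_norm]
          exact ENNReal.ofReal_le_ofReal hvr'
      _ = ENNReal.ofReal r * ∫⁻ s in Ioc (0 : ℝ) 1,
            ∫⁻ v in closedBall 0 r, ‖G (x + s • v) - G x‖ₑ ∂μ := by
          rw [lintegral_const_mul' _ _ ENNReal.ofReal_ne_top,
            lintegral_lintegral_swap hmeas2.aemeasurable]
      _ ≤ ENNReal.ofReal r * ∫⁻ s in Ioc (0 : ℝ) 1, η / 2 * μ (closedBall 0 r) := by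
          gcongr 1
          exact setLIntegral_mono measurable_const hdil
      _ = _ := by simp; ring
  have hsecond : ∫⁻ v in closedBall 0 r, ENNReal.ofReal r * ‖G (x + v) - G x‖ₑ ∂μ ≤
      η / 2 * (ENNReal.ofReal r * μ (closedBall 0 r)) := by
    rw [lintegral_const_mul' _ _ ENNReal.ofReal_ne_top]
    calc _ ≤ ENNReal.ofReal r * (η / 2 * μ (closedBall 0 r)) := by
          gcongr
          simpa using hdil 1 (by simp)
      _ = _ := by ring
  unfold taylorDefect
  rw [lintegral_add_right]
  · refine (add_le_add hfirst hsecond).trans_eq ?_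
    rw [← add_mul, ENNReal.add_halves]
  · exact (hGx.comp (measurable_const_add x)).const_mul _

/-- Two points at which the mean Taylor defect is small satisfy a pointwise Taylor estimate. -/
theorem enorm_sub_sub_le_of_lintegral_taylorDefect_le {u : E → F} {G : E → E →L[ℝ] F}
    (hu : Continuous u) (hGm : StronglyMeasurable G) {x y : E} {r : ℝ} (hr : 0 < r)
    (hxy : ‖y - x‖ ≤ r) {η : ℝ≥0∞}
    (hx : ∫⁻ v in closedBall 0 r, taylorDefect u G r x v ∂μ ≤
        η * (ENNReal.ofReal r * μ (closedBall 0 r)))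
    (hy : ∫⁻ v in closedBall 0 r, taylorDefect u G r y v ∂μ ≤
        η * (ENNReal.ofReal r * μ (closedBall 0 r))) :
    ‖u y - u x - G x (y - x)‖ₑ ≤
      2 * ENNReal.ofReal (2 ^ finrank ℝ E) * η * ENNReal.ofReal r := by
  have hshift : ∀ z : E, ∫⁻ v in closedBall 0 r, taylorDefect u G r z v ∂μ =
      ∫⁻ w in closedBall z r, taylorDefect u G r z (w - z) ∂μ := by
    intro z
    rw [← lintegral_indicator measurableSet_closedBall, ← lintegral_indicator
      measurableSet_closedBall, ← lintegral_add_right_eq_self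
      ((closedBall z r).indicator fun w => taylorDefect u G r z (w - z)) z]
    refine lintegral_congr fun v => ?_
    simp [indicator]
  have hmeas : ∀ z : E, Measurable fun w => taylorDefect u G r z (w - z) := fun z =>
    (measurable_taylorDefect hu hGm r).comp (f := fun w => (z, w - z)) (by fun_prop)
  -- The ball of radius `r / 2` about the midpoint lies in both balls of radius `r`, so some `z` in
  -- it has both defects at most their mean there. The volume ratio gives the factor `2 ^ finrank ℝ
  -- E`.
  set m : E := midpoint ℝ x y
  set W := closedBall m (r / 2)
  have hWx : W ⊆ closedBall x r := by
    refine closedBall_subset_closedBall' ?_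
    rw [dist_comm, dist_left_midpoint, dist_comm, dist_eq_norm]
    norm_num
    linarith
  have hWy : W ⊆ closedBall y r := by
    refine closedBall_subset_closedBall' ?_
    rw [dist_midpoint_right, dist_comm, dist_eq_norm]
    norm_num
    linarith
  have hWpos : μ W ≠ 0 := (measure_closedBall_pos μ m (half_pos hr)).ne'
  have hWfin : μ W ≠ ∞ := measure_closedBall_lt_top.ne
  obtain ⟨z, hzW, hz⟩ := exists_le_setLAverage hWpos hWfin
    ((hmeas x).add (hmeas y)).aemeasurable
  have hvol : μ (closedBall (0 : E) r) = ENNReal.ofReal (2 ^ finrank ℝ E) * μ W := by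
    have h1 := Measure.addHaar_closedBall_mul μ (0 : E) zero_le_two (half_pos hr).le
    have h2 : (2 : ℝ) * (r / 2) = r := by ring
    rw [h2] at h1
    rw [h1, Measure.addHaar_closedBall_center μ m]
  have hz2 : taylorDefect u G r x (z - x) + taylorDefect u G r y (z - y) ≤
      2 * ENNReal.ofReal (2 ^ finrank ℝ E) * η * ENNReal.ofReal r := by
    refine hz.trans ?_
    rw [setLAverage_eq, ENNReal.div_le_iff hWpos hWfin]
    simp only [Pi.add_apply]
    rw [lintegral_add_left (hmeas x)]
    calc _ ≤ η * (ENNReal.ofReal r * μ (closedBall 0 r)) +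
          η * (ENNReal.ofReal r * μ (closedBall 0 r)) := by
          refine add_le_add ((lintegral_mono_set hWx).trans ?_)
            ((lintegral_mono_set hWy).trans ?_)
          · rw [← hshift]; exact hx
          · rw [← hshift]; exact hy
      _ = _ := by rw [hvol]; ring
  refine le_trans ?_ hz2
  -- Going from `x` to `y` through `z` requires replacing `G y` by `G x`; the oscillation term in
  -- `taylorDefect` pays for this.
  have hid : u y - u x - G x (y - x) = (u z - u x - G x (z - x)) - (u z - u y - G y (z - y)) +
      ((G z - G y) (z - y) - (G z - G x) (z - y)) := by
    simp only [sub_apply, map_sub]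
    abel
  have hzy : ‖z - y‖ₑ ≤ ENNReal.ofReal r := by
    rw [← ofReal_norm]
    exact ENNReal.ofReal_le_ofReal (mem_closedBall_iff_norm.1 (hWy hzW))
  have hop : ∀ L : E →L[ℝ] F, ‖L (z - y)‖ₑ ≤ ENNReal.ofReal r * ‖L‖ₑ := fun L => by
    refine (L.le_opENorm _).trans ?_
    rw [mul_comm]
    gcongr
  rw [hid]
  simp only [taylorDefect, add_sub_cancel]
  calc _ ≤ (‖u z - u x - G x (z - x)‖ₑ + ‖u z - u y - G y (z - y)‖ₑ) +
        (ENNReal.ofReal r * ‖G z - G y‖ₑ + ENNReal.ofReal r * ‖G z - G x‖ₑ) := by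
        refine (enorm_add_le _ _).trans (add_le_add ?_ ?_)
        · exact enorm_sub_le
        · exact enorm_sub_le.trans (add_le_add (hop _) (hop _))
    _ = _ := by ring

end ApproximateDifferentiability

/-! ### The area inequality for injective Sobolev maps -/

section AreaInequality

open Metric Module

variable {E : Type*} [NormedAddCommGroup E] [NormedSpace ℝ E] [FiniteDimensional ℝ E]
  [MeasurableSpace E] [BorelSpace E] {μ : Measure E} [μ.IsAddHaarMeasure]
  {F : Type*} [NormedAddCommGroup F] [NormedSpace ℝ F] [FiniteDimensional ℝ F]

/-- If the mean Taylor defects at dyadic scales tend to zero uniformly on `S`, then `u` is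
differentiable relative to `S`. -/
theorem hasFDerivWithinAt_of_uniform_taylorDefect {u : E → F} {G : E → E →L[ℝ] F}
    (hu : Continuous u) (hGm : StronglyMeasurable G) {S : Set E}
    (hS : ∀ η : ℝ, 0 < η → ∀ᶠ k : ℕ in atTop, ∀ x ∈ S,
      ∫⁻ v in closedBall 0 ((1 / 2 : ℝ) ^ k), taylorDefect u G ((1 / 2) ^ k) x v ∂μ ≤
        ENNReal.ofReal η * (ENNReal.ofReal ((1 / 2) ^ k) * μ (closedBall 0 ((1 / 2) ^ k))))
    {x : E} (hx : x ∈ S) : HasFDerivWithinAt u (G x) S x := by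
  rw [hasFDerivWithinAt_iff_isLittleO, Asymptotics.isLittleO_iff]
  intro c hc
  -- The two-point estimate contributes `2 * 2 ^ finrank ℝ E`; rounding `‖y - x‖` up to a dyadic
  -- radius costs another factor 2.
  set A : ℝ := 4 * 2 ^ finrank ℝ E with hA
  have hApos : 0 < A := by positivity
  obtain ⟨k₀, hk₀⟩ := eventually_atTop.1 (hS (c / A) (by positivity))
  have hnear : ∀ᶠ y in 𝓝[S] x, ‖y - x‖ < (1 / 2 : ℝ) ^ k₀ := by
    filter_upwards [mem_nhdsWithin_of_mem_nhds (ball_mem_nhds x (by positivity :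
      (0 : ℝ) < (1 / 2) ^ k₀))] with y hy using mem_ball_iff_norm.1 hy
  filter_upwards [hnear, self_mem_nhdsWithin] with y hy hyS
  rcases eq_or_ne y x with rfl | hyx
  · simp
  have hd : 0 < ‖y - x‖ := norm_pos_iff.2 (sub_ne_zero.2 hyx)
  obtain ⟨k, hk1, hk2⟩ := exists_nat_pow_near_of_lt_one hd
    (hy.le.trans (pow_le_one₀ (by norm_num) (by norm_num))) (by norm_num : (0 : ℝ) < 1 / 2)
    (by norm_num)
  have hkk : k₀ ≤ k := by
    by_contra! h
    have : (1 / 2 : ℝ) ^ k₀ ≤ (1 / 2) ^ (k + 1) :=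
      pow_le_pow_of_le_one (by norm_num) (by norm_num) h
    linarith
  have hkp : (0 : ℝ) < (1 / 2) ^ k := by positivity
  have key := enorm_sub_sub_le_of_lintegral_taylorDefect_le (μ := μ) hu hGm hkp hk2
    (hk₀ k hkk x hx) (hk₀ k hkk y hyS)
  have h2 : (2 : ℝ≥0∞) = ENNReal.ofReal 2 := by simp
  rw [← ofReal_norm, h2, ← ENNReal.ofReal_mul (by norm_num), ← ENNReal.ofReal_mul (by positivity),
    ← ENNReal.ofReal_mul (by positivity), ENNReal.ofReal_le_ofReal_iff (by positivity)] at key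
  refine key.trans ?_
  have h3 : (1 / 2 : ℝ) ^ k ≤ 2 * ‖y - x‖ := by
    rw [pow_succ] at hk1; linarith
  calc 2 * 2 ^ finrank ℝ E * (c / A) * (1 / 2) ^ k
      ≤ 2 * 2 ^ finrank ℝ E * (c / A) * (2 * ‖y - x‖) := by gcongr
    _ = c * ‖y - x‖ := by rw [hA]; field_simp; ring

/-- Up to sets of small measure, a continuous map with a weak derivative is differentiable relative
to the set, with the weak derivative as derivative. -/
theorem IsWeakDeriv.exists_hasFDerivWithinAt {U V : Set E} (hV : IsOpen V) (hVfin : μ V ≠ ∞)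
    {u : E → F} {G : E → E →L[ℝ] F} (hw : IsWeakDeriv μ U u G) (hu : Continuous u)
    (hG : Integrable G μ) (hGm : StronglyMeasurable G) {ρ : ℝ} (hρ : 0 < ρ)
    (hVU : ∀ x ∈ V, Metric.ball x ρ ⊆ U) {ε : ℝ} (hε : 0 < ε) :
    ∃ t ⊆ V, MeasurableSet t ∧ μ t ≤ ENNReal.ofReal ε ∧
      ∀ x ∈ V \ t, HasFDerivWithinAt u (G x) (V \ t) x := by
  set D : ℕ → ℝ≥0∞ := fun k =>
    ENNReal.ofReal ((1 / 2) ^ k) * μ (closedBall (0 : E) ((1 / 2) ^ k)) with hD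
  have hpos : ∀ k : ℕ, (0 : ℝ) < (1 / 2) ^ k := fun k => by positivity
  have hD0 : ∀ k, D k ≠ 0 := fun k =>
    mul_ne_zero (by simp) (measure_closedBall_pos μ 0 (hpos k)).ne'
  have hDt : ∀ k, D k ≠ ∞ := fun k =>
    ENNReal.mul_ne_top ENNReal.ofReal_ne_top measure_closedBall_lt_top.ne
  set N : ℕ → E → ℝ≥0∞ := fun k x =>
    (∫⁻ v in closedBall 0 ((1 / 2 : ℝ) ^ k), taylorDefect u G ((1 / 2) ^ k) x v ∂μ) / D k with hN
  have hNm : ∀ k, Measurable (N k) := fun k =>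
    ((measurable_taylorDefect hu hGm _).lintegral_prod_right').div_const _
  have hlim : ∀ᵐ x ∂μ, x ∈ V → Tendsto (fun k => (min (N k x) 1).toReal) atTop (𝓝 0) := by
    filter_upwards [hw.ae_eventually_lintegral_taylorDefect_le hV hu hG hGm hρ hVU] with x hx hxV
    have h1 : Tendsto (fun k => N k x) atTop (𝓝 0) := by
      rw [ENNReal.tendsto_nhds_zero]
      intro η hη
      have hseq : Tendsto (fun k : ℕ => (1 / 2 : ℝ) ^ k) atTop (𝓝[>] 0) :=
        tendsto_nhdsWithin_iff.2 ⟨tendsto_pow_atTop_nhds_zero_of_lt_one (by norm_num)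
          (by norm_num), Eventually.of_forall hpos⟩
      filter_upwards [hseq.eventually (hx hxV η hη.ne')] with k hk
      exact (ENNReal.div_le_iff (hD0 k) (hDt k)).2 hk
    have h2 : Tendsto (fun k => min (N k x) 1) atTop (𝓝 0) := by
      simpa using h1.min (tendsto_const_nhds (x := (1 : ℝ≥0∞)))
    simpa [Function.comp_def] using (ENNReal.tendsto_toReal ENNReal.zero_ne_top).comp h2
  -- Egorov's theorem. Truncation at 1 makes the normalized defects real valued, and is inactive
  -- once they are uniformly below 1.
  obtain ⟨t, htV, htm, htε, hunif⟩ := tendstoUniformlyOn_of_ae_tendsto (μ := μ)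
    (f := fun k x => (min (N k x) 1).toReal) (g := fun _ => 0)
    (fun k => ((hNm k).min measurable_const).ennreal_toReal.stronglyMeasurable)
    stronglyMeasurable_const hV.measurableSet hVfin hlim hε
  refine ⟨t, htV, htm, htε, fun x hx => ?_⟩
  refine hasFDerivWithinAt_of_uniform_taylorDefect (μ := μ) hu hGm (fun η hη => ?_) hx
  filter_upwards [Metric.tendstoUniformlyOn_iff.1 hunif (min η 1) (by positivity)] with k hk x hx
  have h1 := hk x hx
  rw [dist_comm, Real.dist_0_eq_abs, abs_of_nonneg ENNReal.toReal_nonneg, lt_min_iff] at h1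
  rw [← ENNReal.div_le_iff (hD0 k) (hDt k)]
  change N k x ≤ _
  have h3 : min (N k x) 1 ≠ ∞ := ne_top_of_le_ne_top ENNReal.one_ne_top (min_le_right _ _)
  have h2 : min (N k x) 1 < 1 := by
    rw [← ENNReal.toReal_lt_toReal h3 ENNReal.one_ne_top]; simpa using h1.2
  have h4 : min (N k x) 1 = N k x := by
    rcases min_choice (N k x) 1 with h | h
    · exact h
    · rw [h] at h2; exact absurd h2 (lt_irrefl _)
  rw [← h4]
  exact (ENNReal.le_ofReal_iff_toReal_le h3 hη.le).2 h1.1.le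

/-- With exceptional sets of measure at most `2⁻ᵏ`, Borel–Cantelli puts almost every point in only
finitely many of them, and Fatou concludes. -/
theorem lintegral_le_of_forall_diff_le {α : Type*} [MeasurableSpace α] {μ : Measure α}
    {V : Set α} (hV : MeasurableSet V) {φ : α → ℝ≥0∞} (hφ : Measurable φ) {B : ℝ≥0∞}
    (h : ∀ ε : ℝ, 0 < ε → ∃ t ⊆ V, MeasurableSet t ∧ μ t ≤ ENNReal.ofReal ε ∧
      ∫⁻ x in V \ t, φ x ∂μ ≤ B) :
    ∫⁻ x in V, φ x ∂μ ≤ B := by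
  choose t _ htm htε htB using fun k : ℕ => h ((1 / 2) ^ k) (by positivity)
  have hsum : ∑' k, μ (t k) ≠ ∞ := by
    refine ne_top_of_le_ne_top ?_ (ENNReal.tsum_le_tsum htε)
    rw [← ENNReal.ofReal_tsum_of_nonneg (fun k => by positivity) summable_geometric_two]
    exact ENNReal.ofReal_ne_top
  have hae : ∀ᵐ x ∂μ, V.indicator φ x ≤ liminf (fun k => (V \ t k).indicator φ x) atTop := by
    filter_upwards [ae_eventually_notMem hsum] with x hx
    refine le_liminf_of_le (h := ?_)
    filter_upwards [hx] with k hk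
    by_cases hxV : x ∈ V
    · rw [indicator_of_mem hxV, indicator_of_mem (mem_sdiff_of_mem hxV hk)]
    · simp [hxV]
  rw [← lintegral_indicator hV]
  refine (lintegral_mono_ae hae).trans ((lintegral_liminf_le
    fun k => hφ.indicator (hV.diff (htm k))).trans ?_)
  refine liminf_le_of_le (h := fun b hb => ?_)
  obtain ⟨k, hk⟩ := hb.exists
  refine hk.trans ?_
  rw [lintegral_indicator (hV.diff (htm k))]
  exact htB k

/-- The integral of the Jacobian of an injective continuous map with a weak derivative is at most
the volume of the image. -/
theorem IsWeakDeriv.lintegral_abs_det_le {U V : Set E} (hV : IsOpen V) (hVfin : μ V ≠ ∞)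
    {u : E → E} {G : E → E →L[ℝ] E} (hw : IsWeakDeriv μ U u G) (hu : Continuous u)
    (hG : Integrable G μ) (hGm : StronglyMeasurable G) {ρ : ℝ} (hρ : 0 < ρ)
    (hVU : ∀ x ∈ V, Metric.ball x ρ ⊆ U) (hinj : InjOn u V) :
    ∫⁻ x in V, ENNReal.ofReal |(G x).det| ∂μ ≤ μ (u '' V) := by
  have hdet : Measurable fun x => ENNReal.ofReal |(G x).det| :=
    ((ContinuousLinearMap.continuous_det.comp_stronglyMeasurable hGm).norm).measurable.ennreal_ofReal
  refine lintegral_le_of_forall_diff_le hV.measurableSet hdet fun ε hε => ?_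
  obtain ⟨t, htV, htm, htε, hder⟩ := hw.exists_hasFDerivWithinAt hV hVfin hu hG hGm hρ hVU hε
  refine ⟨t, htV, htm, htε, ?_⟩
  rw [lintegral_abs_det_fderiv_eq_addHaar_image μ (hV.measurableSet.diff htm) hder
    (hinj.mono sdiff_subset)]
  exact measure_mono (image_mono sdiff_subset)

end AreaInequality

/-! ### The dilatations `K` and `P` -/

section Dilatation

variable {n : ℕ}

theorem stdVec_eq_basisFun (k : Fin n) :
    stdVec k = EuclideanSpace.basisFun (Fin n) ℝ k := by
  simp [stdVec]

theorem sum_smul_stdVec (v : EuclideanSpace ℝ (Fin n)) : ∑ k, v k • stdVec k = v := by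
  simpa [stdVec_eq_basisFun] using (EuclideanSpace.basisFun (Fin n) ℝ).sum_repr v

theorem continuousLinearMap_ext_stdVec {F : Type*} [NormedAddCommGroup F] [NormedSpace ℝ F]
    {L M : EuclideanSpace ℝ (Fin n) →L[ℝ] F} (h : ∀ k, L (stdVec k) = M (stdVec k)) : L = M := by
  ext v
  rw [← sum_smul_stdVec v]
  simp [h]

theorem toEuclideanCLM_jacobianMatrix_stdVec
    (f : EuclideanSpace ℝ (Fin n) → EuclideanSpace ℝ (Fin n)) (x : EuclideanSpace ℝ (Fin n))
    (k : Fin n) :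
    Matrix.toEuclideanCLM (𝕜 := ℝ) (jacobianMatrix f x) (stdVec k) =
      lineDeriv ℝ f x (stdVec k) := by
  ext i
  simp [jacobianMatrix, stdVec]

theorem det_toEuclideanCLM (A : Matrix (Fin n) (Fin n) ℝ) :
    (Matrix.toEuclideanCLM (𝕜 := ℝ) A).det = A.det := by
  rw [ContinuousLinearMap.det, Matrix.coe_toEuclideanCLM_eq_toEuclideanLin,
    Matrix.toEuclideanLin_eq_toLin_orthonormal, LinearMap.det_toLin]

theorem toEuclideanCLM_jacobianMatrix_eq
    {f : EuclideanSpace ℝ (Fin n) → EuclideanSpace ℝ (Fin n)} {x : EuclideanSpace ℝ (Fin n)}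
    {L : EuclideanSpace ℝ (Fin n) →L[ℝ] EuclideanSpace ℝ (Fin n)}
    (h : ∀ k, lineDeriv ℝ f x (stdVec k) = L (stdVec k)) :
    Matrix.toEuclideanCLM (𝕜 := ℝ) (jacobianMatrix f x) = L :=
  continuousLinearMap_ext_stdVec fun k => by
    rw [toEuclideanCLM_jacobianMatrix_stdVec, h]

/-- The image of the unit ball lies in the ball of radius `‖A‖`; compare volumes. -/
theorem abs_det_le_norm_pow (A : EuclideanSpace ℝ (Fin n) →L[ℝ] EuclideanSpace ℝ (Fin n)) :
    |A.det| ≤ ‖A‖ ^ n := by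
  have h1 : volume (A '' Metric.closedBall 0 1) ≤
      volume (Metric.closedBall (0 : EuclideanSpace ℝ (Fin n)) ‖A‖) := by
    refine measure_mono ?_
    rintro _ ⟨x, hx, rfl⟩
    rw [mem_closedBall_zero_iff] at hx ⊢
    exact (A.le_opNorm x).trans (mul_le_of_le_one_right (norm_nonneg _) hx)
  rw [Measure.addHaar_image_continuousLinearMap,
    Measure.addHaar_closedBall' _ _ (norm_nonneg A), finrank_euclideanSpace_fin] at h1
  have hp := (Metric.measure_closedBall_pos volume (0 : EuclideanSpace ℝ (Fin n)) one_pos).ne'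
  have ht : volume (Metric.closedBall (0 : EuclideanSpace ℝ (Fin n)) 1) ≠ ∞ :=
    measure_closedBall_lt_top.ne
  rw [ENNReal.mul_le_mul_iff_left hp ht] at h1
  exact (ENNReal.ofReal_le_ofReal_iff (by positivity)).1 h1

theorem one_le_outerDil (f : EuclideanSpace ℝ (Fin n) → EuclideanSpace ℝ (Fin n))
    (x : EuclideanSpace ℝ (Fin n)) : 1 ≤ outerDil f x := by
  unfold outerDil
  split_ifs with h1 h2 h3
  · rw [← ENNReal.ofReal_one]
    refine ENNReal.ofReal_le_ofReal ?_
    rw [one_le_div (abs_pos.2 h2), ← det_toEuclideanCLM]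
    exact abs_det_le_norm_pow _
  all_goals simp

theorem one_le_dilP (hn : 2 ≤ n) (f : EuclideanSpace ℝ (Fin n) → EuclideanSpace ℝ (Fin n))
    (x : EuclideanSpace ℝ (Fin n)) : 1 ≤ dilP f x := by
  have : (2 : ℝ) ≤ n := by exact_mod_cast hn
  exact ENNReal.one_le_rpow (one_le_outerDil f x) (by apply div_pos <;> linarith)

theorem dilP_pow (hn : 2 ≤ n) (f : EuclideanSpace ℝ (Fin n) → EuclideanSpace ℝ (Fin n))
    (x : EuclideanSpace ℝ (Fin n)) : dilP f x ^ (n - 1) = outerDil f x := by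
  have h2 : (2 : ℝ) ≤ n := by exact_mod_cast hn
  have h3 : ((n - 1 : ℕ) : ℝ) = (n : ℝ) - 1 := by
    rw [Nat.cast_sub (by omega)]; simp
  rw [dilP, ← ENNReal.rpow_natCast, ← ENNReal.rpow_mul, h3, one_div_mul_cancel (by linarith),
    ENNReal.rpow_one]

theorem outerDil_congr {f g : EuclideanSpace ℝ (Fin n) → EuclideanSpace ℝ (Fin n)}
    {x : EuclideanSpace ℝ (Fin n)} (h : f =ᶠ[𝓝 x] g) : outerDil f x = outerDil g x := by
  have h1 : jacobianMatrix f x = jacobianMatrix g x := by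
    ext i k
    simp [jacobianMatrix, h.lineDeriv_eq]
  have h2 : HasPartials f x ↔ HasPartials g x :=
    forall_congr' fun k => h.lineDifferentiableAt_iff
  rw [outerDil, outerDil, h1]
  by_cases hp : HasPartials f x
  · rw [if_pos hp, if_pos (h2.1 hp)]
  · rw [if_neg hp, if_neg fun h => hp (h2.2 h)]

theorem dilP_congr {f g : EuclideanSpace ℝ (Fin n) → EuclideanSpace ℝ (Fin n)}
    {x : EuclideanSpace ℝ (Fin n)} (h : f =ᶠ[𝓝 x] g) : dilP f x = dilP g x := by
  rw [dilP, dilP, outerDil_congr h]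

/-- Continuity makes the set where the partials exist, and the partials themselves, Borel. This is
one use of the globally continuous extension of a Sobolev map. -/
theorem measurable_outerDil {f : EuclideanSpace ℝ (Fin n) → EuclideanSpace ℝ (Fin n)}
    (hf : Continuous f) : Measurable (outerDil f) := by
  have hp : MeasurableSet {x | HasPartials f x} := by
    simp only [HasPartials, ofPred_forall]
    exact MeasurableSet.iInter fun k => measurableSet_lineDifferentiableAt hf
  let J : EuclideanSpace ℝ (Fin n) → Fin n → Fin n → ℝ := fun x i k => jacobianMatrix f x i k
  have hJ : Measurable J := by
    refine measurable_pi_lambda _ fun i => measurable_pi_lambda _ fun k => ?_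
    exact (EuclideanSpace.proj (𝕜 := ℝ) i).continuous.measurable.comp (measurable_lineDeriv hf)
  have hdet : Measurable fun x => (jacobianMatrix f x).det := by
    have : Continuous fun A : Fin n → Fin n → ℝ => (Matrix.of A).det := by
      have h : Continuous fun A : Matrix (Fin n) (Fin n) ℝ => A.det := continuous_id.matrix_det
      exact h
    exact this.measurable.comp hJ
  have hnorm : Measurable fun x => ‖Matrix.toEuclideanCLM (𝕜 := ℝ) (jacobianMatrix f x)‖ := by
    have : Continuous fun A : Fin n → Fin n → ℝ =>
        ‖Matrix.toEuclideanCLM (𝕜 := ℝ) (Matrix.of A)‖ := by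
      have h : Continuous fun A : Matrix (Fin n) (Fin n) ℝ =>
          Matrix.toEuclideanCLM (𝕜 := ℝ) A :=
        LinearMap.continuous_of_finiteDimensional
          (Matrix.toEuclideanCLM (𝕜 := ℝ) (n := Fin n)).toAlgEquiv.toLinearMap
      exact h.norm
    exact this.measurable.comp hJ
  unfold outerDil
  refine Measurable.ite hp (Measurable.ite ?_ ?_ (Measurable.ite ?_ ?_ ?_)) measurable_const
  · exact (hdet (measurableSet_singleton 0)).compl
  · exact ((hnorm.pow_const n).div hdet.norm).ennreal_ofReal
  · exact hJ (measurableSet_singleton (0 : Fin n → Fin n → ℝ))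
  · exact measurable_const
  · exact measurable_const

theorem measurable_dilP {f : EuclideanSpace ℝ (Fin n) → EuclideanSpace ℝ (Fin n)}
    (hf : Continuous f) : Measurable (dilP f) :=
  (measurable_outerDil hf).pow_const _

end Dilatation

/-! ### From componentwise Sobolev classes to weak derivatives -/

section Sobolev

variable {n : ℕ}

theorem integral_eq_coord {μ : Measure (EuclideanSpace ℝ (Fin n))}
    {f : EuclideanSpace ℝ (Fin n) → EuclideanSpace ℝ (Fin n)} (hf : Integrable f μ) (i : Fin n) :
    (∫ x, f x ∂μ) i = ∫ x, f x i ∂μ :=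
  ((EuclideanSpace.proj (𝕜 := ℝ) i).integral_comp_comm hf).symm

/-- A matrix of integrable functions as a map into continuous linear maps. -/
theorem exists_integrable_clm_of_entries {m : Fin n → Fin n → EuclideanSpace ℝ (Fin n) → ℝ}
    (hm : ∀ i k, StronglyMeasurable (m i k)) (hi : ∀ i k, Integrable (m i k)) :
    ∃ G : EuclideanSpace ℝ (Fin n) → EuclideanSpace ℝ (Fin n) →L[ℝ] EuclideanSpace ℝ (Fin n),
      Integrable G ∧ StronglyMeasurable G ∧ ∀ x v i, G x v i = ∑ k, m i k x * v k := by
  obtain ⟨T, hT⟩ : ∃ T : (Fin n → Fin n → ℝ) →L[ℝ]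
      (EuclideanSpace ℝ (Fin n) →L[ℝ] EuclideanSpace ℝ (Fin n)),
      ∀ a v i, T a v i = ∑ k, a i k * v k := by
    let T₀ : (Fin n → Fin n → ℝ) →ₗ[ℝ]
        (EuclideanSpace ℝ (Fin n) →L[ℝ] EuclideanSpace ℝ (Fin n)) :=
      { toFun := fun a => Matrix.toEuclideanCLM (𝕜 := ℝ) (Matrix.of a)
        map_add' := fun a b => by rw [← map_add]; rfl
        map_smul' := fun c a => by rw [RingHom.id_apply, ← map_smul]; rfl }
    refine ⟨LinearMap.toContinuousLinearMap T₀, fun a v i => ?_⟩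
    simp [T₀, Matrix.mulVec, dotProduct]
  have hpi : Integrable fun x i k => m i k x :=
    Integrable.of_eval fun i => Integrable.of_eval fun k => hi i k
  have hpm : StronglyMeasurable fun x i k => m i k x :=
    (measurable_pi_lambda _ fun i => measurable_pi_lambda _ fun k =>
      (hm i k).measurable).stronglyMeasurable
  exact ⟨fun x => T fun i k => m i k x, T.integrable_comp hpi,
    T.continuous.comp_stronglyMeasurable hpm, fun x v i => hT _ v i⟩

/-- Take a measurable representative and extend it by zero: test functions vanish off `U`, so the
identity passes to integrals over the whole space. -/
theorem IsDistribDeriv.exists_integrable {U : Set (EuclideanSpace ℝ (Fin n))} (hU : IsOpen U)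
    {k : Fin n} {u w : EuclideanSpace ℝ (Fin n) → ℝ} (hw : IntegrableOn w U)
    (h : IsDistribDeriv U k u w) :
    ∃ m : EuclideanSpace ℝ (Fin n) → ℝ, StronglyMeasurable m ∧ Integrable m ∧
      ∀ φ : EuclideanSpace ℝ (Fin n) → ℝ, ContDiff ℝ (⊤ : ℕ∞) φ → HasCompactSupport φ →
        tsupport φ ⊆ U → ∫ x, fderiv ℝ φ x (stdVec k) * u x = -∫ x, φ x * m x := by
  refine ⟨U.indicator (hw.aestronglyMeasurable.mk w),
    hw.aestronglyMeasurable.stronglyMeasurable_mk.indicator hU.measurableSet,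
    (integrable_indicator_iff hU.measurableSet).2 (hw.congr hw.aestronglyMeasurable.ae_eq_mk),
    fun φ hφ hc hsupp => ?_⟩
  have hz : ∀ x, x ∉ U → φ x = 0 ∧ fderiv ℝ φ x = 0 := by
    intro x hx
    have hx' : x ∉ tsupport φ := fun h => hx (hsupp h)
    exact ⟨image_eq_zero_of_notMem_tsupport hx', image_eq_zero_of_notMem_tsupport
      fun h => hx' (tsupport_fderiv_subset ℝ h)⟩
  have h1 := h φ hφ hc hsupp
  rw [setIntegral_eq_integral_of_forall_compl_eq_zero
    (fun x hx => by simp [(hz x hx).2])] at h1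
  have h2 : ∫ x in U, w x * φ x =
      ∫ x, φ x * U.indicator (hw.aestronglyMeasurable.mk w) x := by
    rw [← setIntegral_eq_integral_of_forall_compl_eq_zero (s := U) (μ := volume)
      (f := fun x => φ x * U.indicator (hw.aestronglyMeasurable.mk w) x)
      (fun x hx => by simp [(hz x hx).1])]
    refine integral_congr_ae ?_
    filter_upwards [hw.aestronglyMeasurable.ae_eq_mk,
      ae_restrict_mem hU.measurableSet] with x hx hxU
    rw [indicator_of_mem hxU, ← hx, mul_comm]
  rw [← h2, ← h1]
  simp only [mul_comm]

/-- Componentwise distributional derivatives of a continuous map assemble to a weak derivative. -/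
theorem exists_isWeakDeriv {U : Set (EuclideanSpace ℝ (Fin n))} (hU : IsOpen U)
    {u : EuclideanSpace ℝ (Fin n) → EuclideanSpace ℝ (Fin n)} (hu : Continuous u)
    (h : ∀ i, MemW11 U fun x => u x i) :
    ∃ G : EuclideanSpace ℝ (Fin n) → EuclideanSpace ℝ (Fin n) →L[ℝ] EuclideanSpace ℝ (Fin n),
      Integrable G ∧ StronglyMeasurable G ∧ IsWeakDeriv volume U u G := by
  have hm : ∀ i k, ∃ m : EuclideanSpace ℝ (Fin n) → ℝ, StronglyMeasurable m ∧ Integrable m ∧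
      ∀ φ : EuclideanSpace ℝ (Fin n) → ℝ, ContDiff ℝ (⊤ : ℕ∞) φ → HasCompactSupport φ →
        tsupport φ ⊆ U → ∫ x, fderiv ℝ φ x (stdVec k) * u x i = -∫ x, φ x * m x := by
    intro i k
    obtain ⟨w, hw, hwd⟩ := (h i).2 k
    exact hwd.exists_integrable hU hw
  choose m hmm hmint hmd using hm
  obtain ⟨G, hGi, hGm, hGv⟩ := exists_integrable_clm_of_entries hmm hmint
  refine ⟨G, hGi, hGm, fun φ hφ hc hsupp v => ?_⟩
  have hφc := hφ.continuous
  have hfd : Continuous (fderiv ℝ φ) := hφ.continuous_fderiv (by simp)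
  obtain ⟨M, hM⟩ := hφc.bounded_above_of_compact_support hc
  have hi1 : ∀ v, Integrable fun x => fderiv ℝ φ x v • u x := fun v =>
    ((hfd.clm_apply continuous_const).smul hu).integrable_of_hasCompactSupport
      (HasCompactSupport.smul_right (hc.fderiv_apply (𝕜 := ℝ) v))
  have hi2 : Integrable fun x => φ x • G x v :=
    (hGi.apply_continuousLinearMap v).bdd_smul M hφc.aestronglyMeasurable (Eventually.of_forall hM)
  have hi3 : ∀ i k, Integrable fun x => φ x * m i k x := fun i k =>
    (hmint i k).bdd_mul hφc.aestronglyMeasurable (Eventually.of_forall hM)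
  ext i
  rw [integral_eq_coord (hi1 v), PiLp.neg_apply, integral_eq_coord hi2]
  have e1 : ∀ x, (fderiv ℝ φ x v • u x) i =
      ∑ k, v k * (fderiv ℝ φ x (stdVec k) * u x i) := by
    intro x
    conv_lhs => rw [← sum_smul_stdVec v]
    simp [map_sum, Finset.sum_mul, mul_assoc]
  have e2 : ∀ x, (φ x • G x v) i = ∑ k, v k * (φ x * m i k x) := by
    intro x
    rw [PiLp.smul_apply, hGv, smul_eq_mul, Finset.mul_sum]
    exact Finset.sum_congr rfl fun k _ => by ring
  simp only [e1, e2]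
  rw [integral_finsetSum, integral_finsetSum, ← Finset.sum_neg_distrib]
  · refine Finset.sum_congr rfl fun k _ => ?_
    rw [integral_const_mul, integral_const_mul, hmd i k φ hφ hc hsupp, mul_neg]
  · exact fun k _ => (hi3 i k).const_mul _
  · intro k _
    exact ((EuclideanSpace.proj (𝕜 := ℝ) i).integrable_comp (hi1 (stdVec k))).const_mul _

/-- Near a compact set, a continuous Sobolev map agrees with a globally continuous map that has an
integrable weak derivative. -/
theorem MemW11loc.exists_extension {D K : Set (EuclideanSpace ℝ (Fin n))} (hD : IsOpen D)
    (hK : IsCompact K) (hKD : K ⊆ D)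
    {g : EuclideanSpace ℝ (Fin n) → EuclideanSpace ℝ (Fin n)} (hg : ContinuousOn g D)
    (hs : MemW11loc D g) :
    ∃ (U : Set (EuclideanSpace ℝ (Fin n))) (ρ : ℝ)
      (u : EuclideanSpace ℝ (Fin n) → EuclideanSpace ℝ (Fin n))
      (G : EuclideanSpace ℝ (Fin n) → EuclideanSpace ℝ (Fin n) →L[ℝ] EuclideanSpace ℝ (Fin n)),
      IsOpen U ∧ U ⊆ D ∧ 0 < ρ ∧ (∀ x ∈ K, Metric.ball x ρ ⊆ U) ∧ Continuous u ∧ EqOn u g U ∧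
      Integrable G ∧ StronglyMeasurable G ∧ IsWeakDeriv volume U u G := by
  obtain ⟨δ, hδ, hδD⟩ := hK.exists_cthickening_subset_open hD hKD
  set U := Metric.thickening δ K
  set K' := Metric.cthickening δ K
  have hUK : U ⊆ K' := Metric.thickening_subset_cthickening δ K
  have hcl : closure U ⊆ K' := Metric.closure_thickening_subset_cthickening δ K
  have hK' : IsCompact K' := hK.cthickening
  have hUo : IsOpen U := Metric.isOpen_thickening
  let g' : C(K', EuclideanSpace ℝ (Fin n)) :=
    ⟨fun x => g x, continuousOn_iff_continuous_domRestrict.1 (hg.mono hδD)⟩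
  -- Tietze extension from the closed thickening. Only values on `U` enter the weak derivative
  -- there.
  obtain ⟨u, hu⟩ := ContinuousMap.exists_extension (Metric.isClosed_cthickening
    (δ := δ) (E := K)).isClosedEmbedding_subtypeVal g'
  have hug : EqOn u g K' := fun x hx => DFunLike.congr_fun hu ⟨x, hx⟩
  have hW : ∀ i, MemW11 U fun x => u x i := by
    intro i
    obtain ⟨h1, h2⟩ := hs i U hUo (hK'.of_isClosed_subset isClosed_closure hcl)
      (hcl.trans hδD)
    have he : EqOn (fun x => u x i) (fun x => g x i) U := fun x hx => by
      simp only [hug (hUK hx)]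
    refine ⟨h1.congr_fun he.symm hUo.measurableSet, fun k => ?_⟩
    obtain ⟨v, hv, hvd⟩ := h2 k
    refine ⟨v, hv, fun φ h3 h4 h5 => ?_⟩
    rw [← hvd φ h3 h4 h5]
    exact setIntegral_congr_fun hUo.measurableSet fun x hx => by simp only [hug (hUK hx)]
  obtain ⟨G, hGi, hGm, hGw⟩ := exists_isWeakDeriv hUo u.continuous hW
  exact ⟨U, δ, u, G, hUo, hUK.trans hδD, hδ, fun x hx => Metric.ball_subset_thickening hx δ,
    u.continuous, hug.mono hUK, hGi, hGm, hGw⟩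

end Sobolev

/-! ### Boxes and cubes in an orthonormal basis -/

section Boxes

variable {n : ℕ}

/-- The open box centred at `x₀` with edges parallel to the basis `e` whose extent in the direction
`e i` is `(a i, b i)`. -/
def openBox (e : OrthonormalBasis (Fin n) ℝ (EuclideanSpace ℝ (Fin n)))
    (x₀ : EuclideanSpace ℝ (Fin n)) (a b : Fin n → ℝ) : Set (EuclideanSpace ℝ (Fin n)) :=
  {y | ∀ i, inner ℝ (e i) (y - x₀) ∈ Ioo (a i) (b i)}

theorem isOpen_openBox (e : OrthonormalBasis (Fin n) ℝ (EuclideanSpace ℝ (Fin n)))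
    (x₀ : EuclideanSpace ℝ (Fin n)) (a b : Fin n → ℝ) : IsOpen (openBox e x₀ a b) := by
  simp only [openBox, ofPred_forall]
  refine isOpen_iInter_of_finite fun i => ?_
  exact isOpen_Ioo.preimage (f := fun y => inner ℝ (e i) (y - x₀)) (by fun_prop)

theorem volume_forall_inner_mem (e : OrthonormalBasis (Fin n) ℝ (EuclideanSpace ℝ (Fin n)))
    (x₀ : EuclideanSpace ℝ (Fin n)) {s : Fin n → Set ℝ} (hs : ∀ i, MeasurableSet (s i)) :
    volume {y | ∀ i, inner ℝ (e i) (y - x₀) ∈ s i} = ∏ i, volume (s i) := by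
  have h1 : MeasurePreserving fun y : EuclideanSpace ℝ (Fin n) => y - x₀ :=
    measurePreserving_sub_right volume x₀
  have h2 := (EuclideanSpace.volume_preserving_symm_measurableEquiv_toLp (Fin n)).comp
    (e.measurePreserving_repr.comp h1)
  have h3 : {y | ∀ i, inner ℝ (e i) (y - x₀) ∈ s i} =
      ((MeasurableEquiv.toLp 2 (Fin n → ℝ)).symm ∘ (e.repr ∘ fun y => y - x₀)) ⁻¹'
        (univ.pi s) := by
    ext y
    simp [e.repr_apply_apply, Set.mem_pi, inner_sub_right]
  rw [h3, h2.measure_preimage (MeasurableSet.univ_pi hs).nullMeasurableSet, volume_pi_pi]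

theorem volume_openBox (e : OrthonormalBasis (Fin n) ℝ (EuclideanSpace ℝ (Fin n)))
    (x₀ : EuclideanSpace ℝ (Fin n)) (a b : Fin n → ℝ) :
    volume (openBox e x₀ a b) = ∏ i, ENNReal.ofReal (b i - a i) := by
  simpa [openBox] using volume_forall_inner_mem e x₀ (s := fun i => Ioo (a i) (b i))
    fun i => measurableSet_Ioo

theorem cube_eq_openBox (e : OrthonormalBasis (Fin n) ℝ (EuclideanSpace ℝ (Fin n)))
    (x₀ : EuclideanSpace ℝ (Fin n)) (h : ℝ) :
    cube e x₀ h = openBox e x₀ (fun _ => -(h / 2)) fun _ => h / 2 := by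
  ext y
  simp [cube, openBox, abs_lt]

theorem isOpen_cube (e : OrthonormalBasis (Fin n) ℝ (EuclideanSpace ℝ (Fin n)))
    (x₀ : EuclideanSpace ℝ (Fin n)) (h : ℝ) : IsOpen (cube e x₀ h) :=
  cube_eq_openBox e x₀ h ▸ isOpen_openBox e x₀ _ _

theorem volume_cube (e : OrthonormalBasis (Fin n) ℝ (EuclideanSpace ℝ (Fin n)))
    (x₀ : EuclideanSpace ℝ (Fin n)) {h : ℝ} (hh : 0 ≤ h) :
    volume (cube e x₀ h) = ENNReal.ofReal (h ^ n) := by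
  rw [cube_eq_openBox, volume_openBox]
  simp [ENNReal.ofReal_pow hh]

theorem norm_le_of_forall_abs_inner_le (e : OrthonormalBasis (Fin n) ℝ (EuclideanSpace ℝ (Fin n)))
    {z : EuclideanSpace ℝ (Fin n)} {r : ℝ} (hz : ∀ i, |inner ℝ (e i) z| ≤ r) : ‖z‖ ≤ n * r := by
  calc ‖z‖ = ‖∑ i, inner ℝ (e i) z • e i‖ := by rw [e.sum_repr' z]
    _ ≤ ∑ i, ‖inner ℝ (e i) z • e i‖ := norm_sum_le _ _
    _ ≤ ∑ _i : Fin n, r := Finset.sum_le_sum fun i _ => by simpa [norm_smul] using hz i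
    _ = n * r := by simp

theorem cube_subset_closedBall (e : OrthonormalBasis (Fin n) ℝ (EuclideanSpace ℝ (Fin n)))
    (x₀ : EuclideanSpace ℝ (Fin n)) (h : ℝ) :
    cube e x₀ h ⊆ Metric.closedBall x₀ (n * (h / 2)) := fun y hy => by
  rw [mem_closedBall_iff_norm]
  exact norm_le_of_forall_abs_inner_le e fun i => (hy i).le

end Boxes

/-! ### Length estimate and Hölder's inequality on a cube -/

section CubeEstimates

variable {n : ℕ}

/-- On a cube where `u` is uniformly close to an affine map `a + A (x - x₀)`, the mean of the norm
of the weak derivative of `u` is almost as large as the stretch of `A` along an edge. -/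
theorem IsWeakDeriv.le_lintegral_cube {U : Set (EuclideanSpace ℝ (Fin n))}
    {u : EuclideanSpace ℝ (Fin n) → EuclideanSpace ℝ (Fin n)}
    {G : EuclideanSpace ℝ (Fin n) → EuclideanSpace ℝ (Fin n) →L[ℝ] EuclideanSpace ℝ (Fin n)}
    (hw : IsWeakDeriv volume U u G) (hu : Continuous u) (hG : Integrable G)
    (hGm : StronglyMeasurable G)
    {e : OrthonormalBasis (Fin n) ℝ (EuclideanSpace ℝ (Fin n))} {x₀ a : EuclideanSpace ℝ (Fin n)}
    {h : ℝ} (hh : 0 < h) (hU : cube e x₀ h ⊆ U)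
    {A : EuclideanSpace ℝ (Fin n) →L[ℝ] EuclideanSpace ℝ (Fin n)} {ε : ℝ} (hε : 0 < ε) (hε1 : ε < 1)
    (hA : ∀ x ∈ cube e x₀ h, ‖u x - a - A (x - x₀)‖ ≤ ε * h) (i : Fin n) :
    ENNReal.ofReal (‖A (e i)‖ * (1 - ε) - 2 * ε) * ENNReal.ofReal (h ^ n) ≤
      ∫⁻ x in cube e x₀ h, ‖G x‖ₑ := by
  classical
  set C := cube e x₀ h with hC
  have hε' : 0 < 1 - ε := by linarith
  set t : ℝ := (1 - ε) * h with ht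
  have htpos : 0 < t := by positivity
  -- A slab of thickness `ε * h` at one face orthogonal to `e i`: segments of length `t = (1 - ε) *
  -- h` starting in it stay in the cube.
  set S := openBox e x₀ (fun _ => -(h / 2))
    (Function.update (fun _ => h / 2) i (-(h / 2) + ε * h)) with hS
  have hmemS : ∀ y, y ∈ S ↔ (inner ℝ (e i) (y - x₀) ∈ Ioo (-(h / 2)) (-(h / 2) + ε * h) ∧
      ∀ k, k ≠ i → inner ℝ (e k) (y - x₀) ∈ Ioo (-(h / 2)) (h / 2)) := by
    intro y
    constructor
    · intro hy
      refine ⟨by simpa using hy i, fun k hk => by simpa [hk] using hy k⟩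
    · rintro ⟨h1, h2⟩ k
      by_cases hk : k = i
      · subst hk; simpa using h1
      · simpa [hk] using h2 k hk
  have hvolS : volume S = ENNReal.ofReal (ε * h ^ n) := by
    rw [hS, volume_openBox, ← Finset.mul_prod_erase _ _ (Finset.mem_univ i),
      Finset.prod_congr rfl (g := fun _ => ENNReal.ofReal h)]
    · obtain ⟨m, rfl⟩ : ∃ m, n = m + 1 := ⟨n - 1, by have := i.pos; omega⟩
      simp only [Function.update_self, Finset.prod_const, Finset.card_erase_of_mem
        (Finset.mem_univ i), Finset.card_univ, Fintype.card_fin, Nat.add_sub_cancel]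
      rw [← ENNReal.ofReal_pow hh.le, ← ENNReal.ofReal_mul (by
        rw [add_sub_cancel_left]; positivity)]
      congr 1; ring
    · intro k hk
      simp [Finset.ne_of_mem_erase hk]
  have hinner : ∀ (k : Fin n) (y : EuclideanSpace ℝ (Fin n)) (s : ℝ),
      inner ℝ (e k) (y + s • (t • e i) - x₀) =
        inner ℝ (e k) (y - x₀) + if k = i then s * t else 0 := by
    intro k y s
    rw [add_sub_right_comm, inner_add_right, inner_smul_right, inner_smul_right,
      orthonormal_iff_ite.1 e.orthonormal k i]
    split_ifs <;> simp
  have hSC : ∀ x ∈ S, ∀ s ∈ Icc (0 : ℝ) 1, x + s • (t • e i) ∈ C := by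
    intro x hx s hs k
    rw [hinner]
    obtain ⟨h1, h2⟩ := (hmemS x).1 hx
    by_cases hk : k = i
    · subst hk
      rw [if_pos rfl, abs_lt]
      have h3 : s * t ≤ t := mul_le_of_le_one_left htpos.le hs.2
      have h4 : 0 ≤ s * t := mul_nonneg hs.1 htpos.le
      constructor
      · linarith [h1.1]
      · have := h1.2; rw [ht] at h3 h4 ⊢; linarith
    · rw [if_neg hk, add_zero, abs_lt]
      exact h2 k hk
  have hc : ∀ x ∈ S, ENNReal.ofReal ((‖A (e i)‖ * (1 - ε) - 2 * ε) * h) ≤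
      ‖u (x + t • e i) - u x‖ₑ := by
    intro x hx
    have h0 := hA _ (by simpa using hSC x hx 0 (by simp))
    have h1 := hA _ (by simpa using hSC x hx 1 (by simp))
    rw [← ofReal_norm]
    refine ENNReal.ofReal_le_ofReal ?_
    have hid : A (t • e i) = (u (x + t • e i) - u x) - (u (x + t • e i) - a - A (x + t • e i - x₀))
        + (u x - a - A (x - x₀)) := by
      rw [add_sub_right_comm x, map_add]; abel
    have hn : ‖A (t • e i)‖ = t * ‖A (e i)‖ := by
      rw [map_smul, norm_smul, Real.norm_of_nonneg htpos.le]
    have h2 : ‖A (t • e i)‖ ≤ ‖u (x + t • e i) - u x‖ + ε * h + ε * h := by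
      rw [hid]
      exact (norm_add_le _ _).trans (add_le_add ((norm_sub_le _ _).trans (by gcongr)) h0)
    rw [hn, ht] at h2
    linarith
  -- The slab has thickness `ε * h` and `s` moves at speed `t`. The resulting factor `ε * h` later
  -- cancels against `volume S = ε * h ^ n`.
  have hθ : ∀ y ∈ C, volume {s : ℝ | y - s • (t • e i) ∈ S} ≤ ENNReal.ofReal (ε * h / t) := by
    intro y _
    set c := inner ℝ (e i) (y - x₀)
    have : {s : ℝ | y - s • (t • e i) ∈ S} ⊆
        Ioo ((c + h / 2 - ε * h) / t) ((c + h / 2) / t) := by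
      intro s hs
      have h1 := ((hmemS _).1 hs).1
      have h2 := hinner i y (-s)
      rw [neg_smul, ← sub_eq_add_neg, if_pos rfl] at h2
      rw [h2] at h1
      constructor
      · rw [div_lt_iff₀ htpos]; linarith [h1.2]
      · rw [lt_div_iff₀ htpos]; linarith [h1.1]
    refine (measure_mono this).trans_eq ?_
    rw [Real.volume_Ioo]
    congr 1
    ring
  have key := hw.mul_measure_le_lintegral (isOpen_openBox e x₀ _ _) (isOpen_cube e x₀ h).measurableSet
    hU hu hG hGm (t • e i) hSC hc hθ
  have hle : ∫⁻ y in C, ‖G y (t • e i)‖ₑ ≤ ENNReal.ofReal t * ∫⁻ y in C, ‖G y‖ₑ := by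
    rw [← lintegral_const_mul' _ _ ENNReal.ofReal_ne_top]
    refine lintegral_mono fun y => ((G y).le_opENorm _).trans_eq ?_
    rw [mul_comm, ← ofReal_norm (t • e i), norm_smul, e.norm_eq_one, mul_one,
      Real.norm_of_nonneg htpos.le]
  have key2 : ENNReal.ofReal (ε * h) * (ENNReal.ofReal (‖A (e i)‖ * (1 - ε) - 2 * ε) *
      ENNReal.ofReal (h ^ n)) ≤ ENNReal.ofReal (ε * h) * ∫⁻ y in C, ‖G y‖ₑ := by
    calc _ = ENNReal.ofReal ((‖A (e i)‖ * (1 - ε) - 2 * ε) * h) * volume S := by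
          rw [hvolS, ENNReal.ofReal_mul hε.le, ENNReal.ofReal_mul hε.le, ENNReal.ofReal_mul' hh.le]
          ring
      _ ≤ ENNReal.ofReal (ε * h / t) * (ENNReal.ofReal t * ∫⁻ y in C, ‖G y‖ₑ) :=
          key.trans (by gcongr)
      _ = _ := by
          rw [← mul_assoc, ← ENNReal.ofReal_mul (by positivity), div_mul_cancel₀ _ htpos.ne']
  exact (ENNReal.mul_le_mul_iff_right (by simp; positivity) ENNReal.ofReal_ne_top).1 key2

/-- Hölder's inequality relating the derivative, the dilatation and the Jacobian. -/
theorem lintegral_enorm_pow_le (hn : 2 ≤ n) {C : Set (EuclideanSpace ℝ (Fin n))}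
    {u : EuclideanSpace ℝ (Fin n) → EuclideanSpace ℝ (Fin n)} (hu : Continuous u)
    {G : EuclideanSpace ℝ (Fin n) → EuclideanSpace ℝ (Fin n) →L[ℝ] EuclideanSpace ℝ (Fin n)}
    (hGm : StronglyMeasurable G) (hC : MeasurableSet C)
    (hder : ∀ v, ∀ᵐ x, x ∈ C → LineDifferentiableAt ℝ u x v → lineDeriv ℝ u x v = G x v)
    (hP : ∫⁻ x in C, dilP u x ≠ ∞) :
    (∫⁻ x in C, ‖G x‖ₑ) ^ n ≤
      (∫⁻ x in C, dilP u x) ^ (n - 1) * ∫⁻ x in C, ENNReal.ofReal |(G x).det| := by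
  have hn0 : (0 : ℝ) < n := by positivity
  have hn2 : (2 : ℝ) ≤ n := by exact_mod_cast hn
  have hn1 : ((n - 1 : ℕ) : ℝ) = (n : ℝ) - 1 := by rw [Nat.cast_sub (by omega)]; simp
  have hdet : Measurable fun x => ENNReal.ofReal |(G x).det| :=
    ((ContinuousLinearMap.continuous_det.comp_stronglyMeasurable hGm).norm).measurable.ennreal_ofReal
  set p : ℝ := n / (n - 1) with hp
  have hpq : p.HolderConjugate n := 
    (Real.HolderConjugate.conjExponent (by linarith : (1 : ℝ) < n)).symm
  have hp0 : p ≠ 0 := hpq.ne_zero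
  -- Finiteness of `∫ P` makes `K` finite almost everywhere, so the partials exist and agree with
  -- `G`, and `det G = 0` forces `G = 0`. Otherwise `P ^ (1 / p) = K ^ (1 / n)`, and equality holds.
  have hpt : ∀ᵐ x, x ∈ C →
      ‖G x‖ₑ ≤ dilP u x ^ (1 / p) * ENNReal.ofReal |(G x).det| ^ (1 / (n : ℝ)) := by
    have hfin := (ae_restrict_iff' hC).1 (ae_lt_top (measurable_dilP hu) hP)
    have hall := ae_all_iff.2 fun k : Fin n => hder (stdVec k)
    filter_upwards [hfin, hall] with x hx hk hxC
    have hKfin : outerDil u x ≠ ∞ := by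
      rw [← dilP_pow hn]; exact ENNReal.pow_ne_top (hx hxC).ne
    have hpart : HasPartials u x := by
      by_contra hcon
      exact hKfin (by rw [outerDil, if_neg hcon])
    have hJ := toEuclideanCLM_jacobianMatrix_eq fun k => hk k hxC (hpart k)
    have hd : (jacobianMatrix u x).det = (G x).det := by rw [← hJ, det_toEuclideanCLM]
    by_cases hdet0 : (G x).det = 0
    · have hz : jacobianMatrix u x = 0 := by
        by_contra hcon
        exact hKfin (by rw [outerDil, if_pos hpart, if_neg (by simpa [hd] using hdet0), if_neg hcon])
      have : G x = 0 := by rw [← hJ, hz, map_zero]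
      rw [← ofReal_norm, this, norm_zero, ENNReal.ofReal_zero]
      exact zero_le
    · have hK : outerDil u x = ENNReal.ofReal (‖G x‖ ^ n / |(G x).det|) := by
        rw [outerDil, if_pos hpart, if_pos (by rwa [hd]), hJ, hd]
      have hPK : dilP u x ^ (1 / p) = outerDil u x ^ (1 / (n : ℝ)) := by
        rw [← dilP_pow hn, ← ENNReal.rpow_natCast, ← ENNReal.rpow_mul, hn1, hp]
        congr 1
        field_simp
      rw [hPK, ← ENNReal.mul_rpow_of_nonneg _ _ (by positivity), hK,
        ← ENNReal.ofReal_mul (by positivity), div_mul_cancel₀ _ (abs_ne_zero.2 hdet0),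
        ENNReal.ofReal_pow (norm_nonneg _), ofReal_norm, ← ENNReal.rpow_natCast,
        ← ENNReal.rpow_mul, mul_one_div_cancel hn0.ne', ENNReal.rpow_one]
  have hHol := ENNReal.lintegral_mul_le_Lp_mul_Lq (volume.restrict C) hpq
    (f := fun x => dilP u x ^ (1 / p))
    (g := fun x => ENNReal.ofReal |(G x).det| ^ (1 / (n : ℝ)))
    ((measurable_dilP hu).pow_const _).aemeasurable (hdet.pow_const _).aemeasurable
  simp only [← ENNReal.rpow_mul, one_div_mul_cancel hp0, one_div_mul_cancel hn0.ne',
    ENNReal.rpow_one] at hHol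
  have h1 : ∫⁻ x in C, ‖G x‖ₑ ≤ (∫⁻ x in C, dilP u x) ^ (1 / p) *
      (∫⁻ x in C, ENNReal.ofReal |(G x).det|) ^ (1 / (n : ℝ)) :=
    (lintegral_mono_ae ((ae_restrict_iff' hC).2 hpt)).trans hHol
  calc (∫⁻ x in C, ‖G x‖ₑ) ^ n ≤ _ := pow_le_pow_left' h1 n
    _ = _ := by
      rw [mul_pow, ← ENNReal.rpow_natCast, ← ENNReal.rpow_natCast, ← ENNReal.rpow_mul,
        ← ENNReal.rpow_mul, one_div_mul_cancel hn0.ne', ENNReal.rpow_one, ← ENNReal.rpow_natCast,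
        hn1, hp]
      congr 2
      field_simp

end CubeEstimates

/-! ### Jensen's inequality for lower limits of means -/

section Jensen

variable {n : ℕ} {e : OrthonormalBasis (Fin n) ℝ (EuclideanSpace ℝ (Fin n))}
  {x₀ : EuclideanSpace ℝ (Fin n)}

theorem le_lowerCubeLimit {g : ℕ → EuclideanSpace ℝ (Fin n) → ℝ≥0∞} {c : ℝ≥0∞}
    (hc : ∀ᶠ h : ℝ in 𝓝[>] 0, ∀ᶠ j in atTop,
      c ≤ (∫⁻ y in cube e x₀ h, g j y) / ENNReal.ofReal (h ^ n)) :
    c ≤ lowerCubeLimit e x₀ g :=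
  le_liminf_of_le (h := hc.mono fun _ hh => le_liminf_of_le (h := hh))

theorem eventually_lt_of_lt_lowerCubeLimit {g : ℕ → EuclideanSpace ℝ (Fin n) → ℝ≥0∞} {c : ℝ≥0∞}
    (hc : c < lowerCubeLimit e x₀ g) :
    ∀ᶠ h : ℝ in 𝓝[>] 0, ∀ᶠ j in atTop,
      c < (∫⁻ y in cube e x₀ h, g j y) / ENNReal.ofReal (h ^ n) :=
  (eventually_lt_of_lt_liminf hc).mono fun _ hh => eventually_lt_of_lt_liminf hh

theorem const_le_lowerCubeLimit {g : ℕ → EuclideanSpace ℝ (Fin n) → ℝ≥0∞} {c : ℝ≥0∞}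
    (hc : ∀ j y, c ≤ g j y) : c ≤ lowerCubeLimit e x₀ g := by
  refine le_lowerCubeLimit ?_
  filter_upwards [self_mem_nhdsWithin] with h hh
  have hh' : (0 : ℝ) < h := hh
  refine Eventually.of_forall fun j => ?_
  have h0 : ENNReal.ofReal (h ^ n) ≠ 0 := by simp; positivity
  rw [ENNReal.le_div_iff_mul_le (Or.inl h0) (Or.inl ENNReal.ofReal_ne_top),
    ← volume_cube e x₀ hh'.le]
  calc c * volume (cube e x₀ h) = ∫⁻ _ in cube e x₀ h, c := by simp
    _ ≤ _ := lintegral_mono fun y => hc j y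

/-- Passage from lower bounds of means of `g` to those of `ψ`, when `ψ` lies above an increasing
affine function of `g`. -/
theorem le_lowerCubeLimit_of_affine {g ψ : ℕ → EuclideanSpace ℝ (Fin n) → ℝ≥0∞}
    {m L : ℝ≥0∞} {c : ℝ≥0} (hm : m < lowerCubeLimit e x₀ g)
    (hψ : ∀ j y, L + c * g j y ≤ ψ j y + c * m) : L ≤ lowerCubeLimit e x₀ ψ := by
  refine le_lowerCubeLimit ?_
  filter_upwards [self_mem_nhdsWithin, eventually_lt_of_lt_lowerCubeLimit hm] with h hh hev
  have hh' : (0 : ℝ) < h := hh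
  filter_upwards [hev] with j hj
  have h0 : ENNReal.ofReal (h ^ n) ≠ 0 := by simp; positivity
  rw [ENNReal.le_div_iff_mul_le (Or.inl h0) (Or.inl ENNReal.ofReal_ne_top)]
  rw [ENNReal.lt_div_iff_mul_lt (Or.inl h0) (Or.inl ENNReal.ofReal_ne_top)] at hj
  set H := ENNReal.ofReal (h ^ n) with hH
  have hvol : volume (cube e x₀ h) = H := volume_cube e x₀ hh'.le
  -- The term `c * m` is added on the right to avoid truncated subtraction; being finite after
  -- integration, it cancels.
  have hfin : c * (m * H) ≠ ∞ :=
    ENNReal.mul_ne_top ENNReal.coe_ne_top (ne_top_of_lt hj)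
  refine (ENNReal.add_le_add_iff_right hfin).1 ?_
  calc L * H + c * (m * H) ≤ L * H + c * ∫⁻ y in cube e x₀ h, g j y := by gcongr
    _ ≤ ∫⁻ y in cube e x₀ h, (L + c * g j y) := by
        rw [lintegral_add_left measurable_const, lintegral_const, Measure.restrict_apply_univ, hvol]
        gcongr
        exact lintegral_const_mul_le _ _
    _ ≤ ∫⁻ y in cube e x₀ h, (ψ j y + c * m) := lintegral_mono fun y => hψ j y
    _ = (∫⁻ y in cube e x₀ h, ψ j y) + c * (m * H) := by
        rw [lintegral_add_right _ measurable_const, lintegral_const, Measure.restrict_apply_univ,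
          hvol, mul_assoc]

/-- The line has the slope of the chord over `[s, m]`, lowered to take the value `φs` at `m`.
Outside `[s, m]` convexity keeps even the chord below the graph; inside, the lowered line is at most
`φs`, and monotonicity suffices. -/
theorem three_chord_le {φs φm φt s m t : ℝ} (hsm : s < m) (hφ : φs ≤ φm)
    (h1 : m ≤ t → (t - s) * φm ≤ (t - m) * φs + (m - s) * φt)
    (h2 : s ≤ t → φs ≤ φt)
    (h3 : t < s → (m - t) * φs ≤ (m - s) * φt + (s - t) * φm) :
    φs + (φm - φs) / (m - s) * t ≤ φt + (φm - φs) / (m - s) * m := by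
  have hd : 0 < m - s := sub_pos.2 hsm
  have key : φs * (m - s) + (φm - φs) * t ≤ φt * (m - s) + (φm - φs) * m := by
    rcases lt_or_ge t s with hts | hst
    · nlinarith [h3 hts, mul_nonneg (sub_nonneg.2 hφ) hd.le]
    · rcases le_or_gt m t with hmt | htm
      · nlinarith [h1 hmt, mul_nonneg (sub_nonneg.2 hφ) hd.le]
      · nlinarith [h2 hst, mul_nonneg (sub_nonneg.2 (h2 hst)) hd.le,
          mul_nonneg (sub_nonneg.2 hφ) (sub_nonneg.2 htm.le)]
  have e1 : φs + (φm - φs) / (m - s) * t = (φs * (m - s) + (φm - φs) * t) / (m - s) := by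
    field_simp
  have e2 : φt + (φm - φs) / (m - s) * m = (φt * (m - s) + (φm - φs) * m) / (m - s) := by
    field_simp
  rw [e1, e2]
  gcongr

/-- Convexity of a function on `[1, ∞]` in terms of real numbers. -/
theorem ConvexOn.real_chord_le {Φ : ℝ≥0∞ → ℝ≥0∞} (hΦ : ConvexOn ℝ≥0 (Icc 1 ⊤) Φ)
    {x y z p q r : ℝ≥0} (hx : 1 ≤ x) (hxy : x ≤ y) (hyz : y ≤ z) (hxz : x < z)
    (hp : Φ x = p) (hq : Φ y = q) (hr : Φ z = r) :
    ((z : ℝ) - x) * q ≤ (z - y) * p + (y - x) * r := by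
  have hd : (0 : ℝ) < z - x := sub_pos.2 (by exact_mod_cast hxz)
  have hzy : (0 : ℝ) ≤ z - y := sub_nonneg.2 (by exact_mod_cast hyz)
  have hyx : (0 : ℝ) ≤ y - x := sub_nonneg.2 (by exact_mod_cast hxy)
  let a : ℝ≥0 := ⟨(z - y) / (z - x), by positivity⟩
  let b : ℝ≥0 := ⟨(y - x) / (z - x), by positivity⟩
  have ha : (a : ℝ) = (z - y) / (z - x) := rfl
  have hb : (b : ℝ) = (y - x) / (z - x) := rfl
  have hab : a + b = 1 := by
    rw [← NNReal.coe_inj, NNReal.coe_add, ha, hb]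
    field_simp
    simp
  have hcomb : a * x + b * z = y := by
    rw [← NNReal.coe_inj]
    push_cast
    rw [ha, hb]
    field_simp
    ring
  have hmem : ∀ w : ℝ≥0, 1 ≤ w → (w : ℝ≥0∞) ∈ Icc (1 : ℝ≥0∞) ⊤ := fun w hw =>
    ⟨by exact_mod_cast hw, le_top⟩
  have := hΦ.2 (hmem x hx) (hmem z (hx.trans hxz.le)) (zero_le (a := a)) (zero_le (a := b)) hab
  have e1 : a • (x : ℝ≥0∞) + b • (z : ℝ≥0∞) = (y : ℝ≥0∞) := by
    rw [ENNReal.smul_def, ENNReal.smul_def, smul_eq_mul, smul_eq_mul, ← hcomb]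
    push_cast; rfl
  rw [e1, hq, hp, hr, ENNReal.smul_def, ENNReal.smul_def, smul_eq_mul, smul_eq_mul] at this
  have h4 : q ≤ a * p + b * r := by exact_mod_cast this
  have h5 : (q : ℝ) ≤ (z - y) / (z - x) * p + (y - x) / (z - x) * r := by
    rw [← ha, ← hb]; exact_mod_cast h4
  calc ((z : ℝ) - x) * q ≤ (z - x) * ((z - y) / (z - x) * p + (y - x) / (z - x) * r) := by gcongr
    _ = _ := by field_simp

/-- A nondecreasing convex function on `[1, ∞]` lies above the shifted chord through two of its
points. -/
theorem ConvexOn.exists_affine_le {Φ : ℝ≥0∞ → ℝ≥0∞} (hmono : MonotoneOn Φ (Icc 1 ⊤))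
    (hconv : ConvexOn ℝ≥0 (Icc 1 ⊤) Φ) {s m : ℝ≥0} (hs : 1 ≤ s) (hsm : s < m)
    (hlt : Φ s < Φ m) (hm : Φ m ≠ ∞) :
    ∃ c : ℝ≥0, ∀ t : ℝ≥0∞, 1 ≤ t → Φ s + c * t ≤ Φ t + c * m := by
  obtain ⟨p, hp⟩ : ∃ p : ℝ≥0, Φ s = p := ⟨(Φ s).toNNReal, (ENNReal.coe_toNNReal (ne_top_of_lt hlt)).symm⟩
  obtain ⟨q, hq⟩ : ∃ q : ℝ≥0, Φ m = q := ⟨(Φ m).toNNReal, (ENNReal.coe_toNNReal hm).symm⟩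
  have hpq : p < q := by rw [hp, hq] at hlt; exact_mod_cast hlt
  have hpq' : (p : ℝ) < q := by exact_mod_cast hpq
  have hsm' : (s : ℝ) < m := by exact_mod_cast hsm
  let c : ℝ≥0 := ⟨(q - p) / (m - s), div_nonneg (sub_nonneg.2 hpq'.le) (sub_nonneg.2 hsm'.le)⟩
  have hc : (c : ℝ) = (q - p) / (m - s) := rfl
  have hcpos : 0 < c := by
    rw [← NNReal.coe_pos, hc]; exact div_pos (sub_pos.2 hpq') (sub_pos.2 hsm')
  have hmem : ∀ w : ℝ≥0, 1 ≤ w → (w : ℝ≥0∞) ∈ Icc (1 : ℝ≥0∞) ⊤ := fun w hw =>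
    ⟨by exact_mod_cast hw, le_top⟩
  have hreal : ∀ t : ℝ≥0, 1 ≤ t → Φ s + c * t ≤ Φ t + c * m := by
    intro t ht
    rcases eq_or_ne (Φ t) ∞ with hinf | hfin
    · simp [hinf]
    obtain ⟨r, hr⟩ : ∃ r : ℝ≥0, Φ t = r := ⟨(Φ t).toNNReal, (ENNReal.coe_toNNReal hfin).symm⟩
    have key : (p : ℝ) + (q - p) / (m - s) * t ≤ r + (q - p) / (m - s) * m := by
      refine three_chord_le hsm' hpq'.le (fun h => ?_) (fun h => ?_) (fun h => ?_)
      · have h' : m ≤ t := by exact_mod_cast h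
        exact hconv.real_chord_le hs hsm.le h' (hsm.trans_le h') hp hq hr
      · have h' : s ≤ t := by exact_mod_cast h
        have := hmono (hmem s hs) (hmem t ht) (by exact_mod_cast h')
        rw [hp, hr] at this
        exact_mod_cast this
      · have h' : t < s := by exact_mod_cast h
        linarith [hconv.real_chord_le ht h'.le hsm.le (h'.trans hsm) hr hp hq]
    rw [← hc] at key
    rw [hp, hr]
    exact_mod_cast key
  refine ⟨c, fun t ht => ?_⟩
  rcases eq_or_ne t ∞ with rfl | htop
  · suffices Φ ∞ + c * m = ∞ by rw [this]; exact le_top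
    refine ENNReal.eq_top_of_forall_nnreal_le fun B => ?_
    set T : ℝ≥0 := max 1 (B / c)
    have h1 := hreal T (le_max_left _ _)
    have h2 : Φ T ≤ Φ ∞ := hmono (hmem T (le_max_left _ _)) ⟨le_top, le_rfl⟩ le_top
    have h3 : B ≤ c * T := by
      calc B = c * (B / c) := by field_simp
        _ ≤ c * T := by gcongr; exact le_max_right _ _
    calc (B : ℝ≥0∞) ≤ c * T := by exact_mod_cast h3
      _ ≤ Φ s + c * T := le_add_self
      _ ≤ Φ T + c * m := h1
      _ ≤ _ := by gcongr
  · lift t to ℝ≥0 using htop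
    exact hreal t (by exact_mod_cast ht)

/-- Jensen's inequality for lower cube limits. -/
theorem apply_le_lowerCubeLimit_comp {g : ℕ → EuclideanSpace ℝ (Fin n) → ℝ≥0∞}
    (hg : ∀ j y, 1 ≤ g j y) {M : ℝ≥0∞} (hM1 : 1 ≤ M) (hM : M ≤ lowerCubeLimit e x₀ g)
    {Φ : ℝ≥0∞ → ℝ≥0∞} (hcont : ContinuousOn Φ (Icc 1 ⊤)) (hmono : MonotoneOn Φ (Icc 1 ⊤))
    (hconv : ConvexOn ℝ≥0 (Icc 1 ⊤) Φ) :
    Φ M ≤ lowerCubeLimit e x₀ fun j y => Φ (g j y) := by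
  have hIcc : ∀ t : ℝ≥0∞, 1 ≤ t → t ∈ Icc (1 : ℝ≥0∞) ⊤ := fun t ht => ⟨ht, le_top⟩
  have hbase : Φ 1 ≤ lowerCubeLimit e x₀ fun j y => Φ (g j y) :=
    const_le_lowerCubeLimit fun j y => hmono (hIcc 1 le_rfl) (hIcc _ (hg j y)) (hg j y)
  refine le_of_forall_lt fun L hL => ?_
  obtain ⟨L₁, hL₁, hL₁M⟩ := exists_between hL
  refine hL₁.trans_le ?_
  rcases le_or_gt L₁ (Φ 1) with h1 | h1
  · exact h1.trans hbase
  obtain ⟨L₂, hL₂, hL₂M⟩ := exists_between hL₁M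
  -- `M` or `Φ M` may be infinite, so no supporting line at `M` is used. Continuity gives `s < m <
  -- M` with `Φ s = L₁` and `Φ m = L₂`, and the chord over `[s, m]` has finite slope.
  have hivt := intermediate_value_Icc hM1 (hcont.mono (Icc_subset_Icc_right le_top))
  obtain ⟨s, hs, hΦs⟩ := hivt ⟨h1.le, hL₁M.le⟩
  obtain ⟨m, hm, hΦm⟩ := hivt ⟨(h1.trans hL₂).le, hL₂M.le⟩
  have hsm : s < m := by
    by_contra! h
    have := hmono (hIcc m hm.1) (hIcc s hs.1) h
    rw [hΦs, hΦm] at this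
    exact absurd hL₂ this.not_gt
  have hmM : m < M := lt_of_le_of_ne hm.2 (by rintro rfl; exact absurd hL₂M (by rw [hΦm]; exact lt_irrefl _))
  lift m to ℝ≥0 using ne_top_of_lt hmM
  lift s to ℝ≥0 using ne_top_of_lt hsm
  obtain ⟨c, hc⟩ := hconv.exists_affine_le hmono (s := s) (m := m) (by exact_mod_cast hs.1)
    (by exact_mod_cast hsm) (by rwa [hΦs, hΦm]) (by rw [hΦm]; exact ne_top_of_lt hL₂M)
  rw [← hΦs]
  exact le_lowerCubeLimit_of_affine (hmM.trans_le hM) fun j y => hc _ (hg j y)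

theorem convexOn_ennreal_pow (k : ℕ) (hk : 1 ≤ k) :
    ConvexOn ℝ≥0 (Icc (1 : ℝ≥0∞) ⊤) fun t => t ^ k := by
  have hab : ∀ {a b : ℝ≥0}, a + b = 1 → (a : ℝ≥0∞) + b = 1 := fun h => by exact_mod_cast h
  refine ⟨fun x hx y hy a b _ _ h => ⟨?_, le_top⟩, fun x hx y hy a b _ _ h => ?_⟩
  · rw [ENNReal.smul_def, ENNReal.smul_def, smul_eq_mul, smul_eq_mul, ← hab h]
    gcongr
    · exact le_mul_of_one_le_right zero_le hx.1
    · exact le_mul_of_one_le_right zero_le hy.1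
  · simp only [ENNReal.smul_def, smul_eq_mul]
    have := ENNReal.rpow_arith_mean_le_arith_mean2_rpow a b x y (hab h)
      (p := k) (by exact_mod_cast hk)
    simpa only [ENNReal.rpow_natCast] using this

end Jensen

/-! ### The length-volume estimate and the limit -/

section LowerSemicontinuity

open scoped Pointwise

variable {n : ℕ}

/-- In an eigenbasis `‖A v‖²` is diagonal with coefficients `‖A (e k)‖²`, so the largest one gives
the norm. This is what the choice of the edges is for. -/
theorem IsPrincipalAxes.exists_norm_eq (hn : n ≠ 0)
    {A : EuclideanSpace ℝ (Fin n) →L[ℝ] EuclideanSpace ℝ (Fin n)}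
    {e : OrthonormalBasis (Fin n) ℝ (EuclideanSpace ℝ (Fin n))} (he : IsPrincipalAxes A e) :
    ∃ i, ‖A (e i)‖ = ‖A‖ := by
  have : Nonempty (Fin n) := Fin.pos_iff_nonempty.1 (Nat.pos_of_ne_zero hn)
  obtain ⟨i, hi⟩ := Finite.exists_max fun i => ‖A (e i)‖
  refine ⟨i, le_antisymm ?_ ?_⟩
  · simpa [e.norm_eq_one] using A.le_opNorm (e i)
  refine A.opNorm_le_bound (norm_nonneg _) fun v => ?_
  choose μ hμ using he
  have hμn : ∀ k, μ k = ‖A (e k)‖ ^ 2 := by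
    intro k
    rw [← real_inner_self_eq_norm_sq, ← ContinuousLinearMap.adjoint_inner_left, hμ,
      real_inner_smul_left, real_inner_self_eq_norm_sq, e.norm_eq_one]
    simp
  have h1 : ‖A v‖ ^ 2 = ∑ k, μ k * inner ℝ (e k) v ^ 2 := by
    rw [← real_inner_self_eq_norm_sq, ← ContinuousLinearMap.adjoint_inner_left,
      ← e.sum_inner_mul_inner]
    refine Finset.sum_congr rfl fun k _ => ?_
    rw [ContinuousLinearMap.adjoint_inner_left, ← ContinuousLinearMap.adjoint_inner_right, hμ,
      real_inner_smul_right, real_inner_comm v (e k)]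
    ring
  have h2 : ‖v‖ ^ 2 = ∑ k, inner ℝ (e k) v ^ 2 := by
    rw [← real_inner_self_eq_norm_sq, ← e.sum_inner_mul_inner]
    refine Finset.sum_congr rfl fun k _ => ?_
    rw [real_inner_comm v (e k)]
    ring
  refine (sq_le_sq₀ (norm_nonneg _) (by positivity)).1 ?_
  rw [mul_pow, h1, h2, Finset.mul_sum]
  refine Finset.sum_le_sum fun k _ => ?_
  rw [hμn]
  gcongr
  exact hi k

/-- The volume of the image of a cube under a map that is uniformly close to an affine map. -/
theorem volume_image_cube_le {e : OrthonormalBasis (Fin n) ℝ (EuclideanSpace ℝ (Fin n))}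
    {x₀ a : EuclideanSpace ℝ (Fin n)} {h : ℝ} (hh : 0 < h)
    {A : EuclideanSpace ℝ (Fin n) →L[ℝ] EuclideanSpace ℝ (Fin n)} {ε : ℝ}
    {g : EuclideanSpace ℝ (Fin n) → EuclideanSpace ℝ (Fin n)}
    (hA : ∀ x ∈ cube e x₀ h, ‖g x - a - A (x - x₀)‖ ≤ ε * h) :
    volume (g '' cube e x₀ h) ≤ ENNReal.ofReal (h ^ n) *
      volume (Metric.cthickening ε
        (A '' {y | ∀ i, inner ℝ (e i) (y - 0) ∈ Icc (-(1 / 2) : ℝ) (1 / 2)})) := by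
  set T := Metric.cthickening ε
    (A '' {y | ∀ i, inner ℝ (e i) (y - 0) ∈ Icc (-(1 / 2) : ℝ) (1 / 2)})
  have hsub : g '' cube e x₀ h ⊆ (fun z => a + z) '' (h • T) := by
    rintro _ ⟨x, hx, rfl⟩
    refine ⟨g x - a, ⟨h⁻¹ • (g x - a), ?_, smul_inv_smul₀ hh.ne' _⟩, add_sub_cancel _ _⟩
    refine Metric.mem_cthickening_of_dist_le _ (A (h⁻¹ • (x - x₀))) _ _
      (mem_image_of_mem _ fun i => ?_) ?_
    · have := abs_lt.1 (hx i)
      rw [sub_zero, real_inner_smul_right, inv_mul_eq_div]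
      constructor
      · rw [le_div_iff₀ hh]; linarith
      · rw [div_le_iff₀ hh]; linarith
    · rw [dist_eq_norm, map_smul, ← smul_sub, norm_smul, Real.norm_of_nonneg (by positivity),
        inv_mul_eq_div, div_le_iff₀ hh]
      exact hA x hx
  refine (measure_mono hsub).trans_eq ?_
  rw [image_add_left, measure_preimage_add, Measure.addHaar_smul, finrank_euclideanSpace_fin,
    abs_of_pos (pow_pos hh n)]

/-- The basic length-volume estimate: a lower bound for the mean of `dilP g` over a cube on which
`g` is uniformly close to an affine map. -/
theorem MemW11loc.le_mean_dilP (hn : 2 ≤ n) {D : Set (EuclideanSpace ℝ (Fin n))} (hD : IsOpen D)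
    {g : EuclideanSpace ℝ (Fin n) → EuclideanSpace ℝ (Fin n)}
    (hg : ContinuousOn g D) (hinj : InjOn g D) (hs : MemW11loc D g)
    {e : OrthonormalBasis (Fin n) ℝ (EuclideanSpace ℝ (Fin n))}
    {x₀ a : EuclideanSpace ℝ (Fin n)} {h : ℝ} (hh : 0 < h)
    (hball : Metric.closedBall x₀ (n * (h / 2)) ⊆ D)
    {A : EuclideanSpace ℝ (Fin n) →L[ℝ] EuclideanSpace ℝ (Fin n)} {ε : ℝ} (hε : 0 < ε)
    (hε1 : ε < 1) (hA : ∀ x ∈ cube e x₀ h, ‖g x - a - A (x - x₀)‖ ≤ ε * h) (i : Fin n)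
    {B : ℝ≥0∞} (hB : volume (g '' cube e x₀ h) ≤ ENNReal.ofReal (h ^ n) * B) :
    (ENNReal.ofReal (‖A (e i)‖ * (1 - ε) - 2 * ε) ^ n / B) ^ (1 / ((n : ℝ) - 1)) ≤
      (∫⁻ y in cube e x₀ h, dilP g y) / ENNReal.ofReal (h ^ n) := by
  obtain ⟨U, ρ, u, G, hUo, hUD, hρ, hKU, hu, hug, hGi, hGm, hw⟩ :=
    hs.exists_extension hD (isCompact_closedBall x₀ (n * (h / 2))) hball hg
  set C := cube e x₀ h
  have hCo : IsOpen C := isOpen_cube e x₀ h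
  have hCK : C ⊆ Metric.closedBall x₀ (n * (h / 2)) := cube_subset_closedBall e x₀ h
  have hCU : C ⊆ U := fun x hx => hKU x (hCK hx) (Metric.mem_ball_self hρ)
  have hug' : EqOn u g C := hug.mono hCU
  have hdil : ∫⁻ y in C, dilP g y = ∫⁻ y in C, dilP u y :=
    setLIntegral_congr_fun hCo.measurableSet fun x hx =>
      dilP_congr (Filter.eventuallyEq_of_mem (hCo.mem_nhds hx) hug'.symm)
  rw [hdil]
  set H := ENNReal.ofReal (h ^ n) with hH
  have hH0 : H ≠ 0 := by simp [hH]; positivity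
  have hHt : H ≠ ∞ := ENNReal.ofReal_ne_top
  by_cases hP : ∫⁻ x in C, dilP u x = ∞
  · rw [hP, ENNReal.top_div_of_ne_top hHt]; exact le_top
  have hKU' : ∀ x ∈ C, Metric.ball x ρ ⊆ U := fun x hx => hKU x (hCK hx)
  have h1 := hw.le_lintegral_cube (a := a) (A := A) hu hGi hGm hh hCU hε hε1
    (fun x hx => by rw [hug' hx]; exact hA x hx) i
  have h2 := lintegral_enorm_pow_le hn hu hGm hCo.measurableSet
    (fun v => hw.ae_lineDeriv_eq hCo hu hGi hGm hρ hKU' v) hP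
  have h3 := hw.lintegral_abs_det_le hCo (by rw [volume_cube e x₀ hh.le]; exact hHt) hu hGi hGm hρ
    hKU' (((hinj.mono hUD).mono hCU).congr hug'.symm)
  rw [hug'.image_eq] at h3
  set c := ENNReal.ofReal (‖A (e i)‖ * (1 - ε) - 2 * ε)
  set I := ∫⁻ x in C, dilP u x
  have hI : I = I / H * H := (ENNReal.div_mul_cancel hH0 hHt).symm
  have hnn : n - 1 + 1 = n := by omega
  -- The powers of `H` balance: `n` from the mean of `‖G‖`, and `n - 1` from `P` plus one from the
  -- image volume.
  have h4 : H ^ n * c ^ n ≤ H ^ n * ((I / H) ^ (n - 1) * B) := by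
    calc H ^ n * c ^ n = (c * H) ^ n := by ring
      _ ≤ (∫⁻ x in C, ‖G x‖ₑ) ^ n := pow_le_pow_left' h1 n
      _ ≤ I ^ (n - 1) * (H * B) := h2.trans (by gcongr; exact h3.trans hB)
      _ = (I / H * H) ^ (n - 1) * (H * B) := by rw [← hI]
      _ = H ^ (n - 1 + 1) * ((I / H) ^ (n - 1) * B) := by ring
      _ = _ := by rw [hnn]
  have h5 : c ^ n / B ≤ (I / H) ^ (n - 1) := by
    refine ENNReal.div_le_of_le_mul ?_
    exact (ENNReal.mul_le_mul_iff_right (pow_ne_zero n hH0) (ENNReal.pow_ne_top hHt)).1 h4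
  have hn2 : (2 : ℝ) ≤ n := by exact_mod_cast hn
  have hn1 : ((n - 1 : ℕ) : ℝ) = (n : ℝ) - 1 := by rw [Nat.cast_sub (by omega)]; simp
  calc _ ≤ ((I / H) ^ (n - 1)) ^ (1 / ((n : ℝ) - 1)) :=
        ENNReal.rpow_le_rpow h5 (by apply div_nonneg <;> linarith)
    _ = I / H := by
      rw [← ENNReal.rpow_natCast, ← ENNReal.rpow_mul, hn1, mul_one_div_cancel (by linarith),
        ENNReal.rpow_one]

theorem hasPartials_of_differentiableAt
    {f : EuclideanSpace ℝ (Fin n) → EuclideanSpace ℝ (Fin n)} {x : EuclideanSpace ℝ (Fin n)}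
    (hf : DifferentiableAt ℝ f x) : HasPartials f x :=
  fun _ => hf.lineDifferentiableAt

theorem toEuclideanCLM_jacobianMatrix_eq_fderiv
    {f : EuclideanSpace ℝ (Fin n) → EuclideanSpace ℝ (Fin n)} {x : EuclideanSpace ℝ (Fin n)}
    (hf : DifferentiableAt ℝ f x) :
    Matrix.toEuclideanCLM (𝕜 := ℝ) (jacobianMatrix f x) = fderiv ℝ f x :=
  toEuclideanCLM_jacobianMatrix_eq fun _ => hf.lineDeriv_eq_fderiv

theorem outerDil_of_fderiv_eq_zero
    {f : EuclideanSpace ℝ (Fin n) → EuclideanSpace ℝ (Fin n)} {x : EuclideanSpace ℝ (Fin n)}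
    (hn : n ≠ 0) (hf : DifferentiableAt ℝ f x) (h : fderiv ℝ f x = 0) : outerDil f x = 1 := by
  have hJ := toEuclideanCLM_jacobianMatrix_eq_fderiv hf
  have hz : jacobianMatrix f x = 0 := by
    rw [h] at hJ
    exact (map_eq_zero_iff _ (Matrix.toEuclideanCLM (𝕜 := ℝ) (n := Fin n)).injective).1 hJ
  have : Nonempty (Fin n) := Fin.pos_iff_nonempty.1 (Nat.pos_of_ne_zero hn)
  rw [outerDil, if_pos (hasPartials_of_differentiableAt hf),
    if_neg (by simp [hz, Matrix.det_zero]), if_pos hz]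

/-- Division in `ℝ≥0∞` also covers `det = 0`: the numerator is nonzero, so the quotient is `∞`. -/
theorem outerDil_of_fderiv_ne_zero
    {f : EuclideanSpace ℝ (Fin n) → EuclideanSpace ℝ (Fin n)} {x : EuclideanSpace ℝ (Fin n)}
    (hf : DifferentiableAt ℝ f x) (h : fderiv ℝ f x ≠ 0) :
    outerDil f x = ENNReal.ofReal ‖fderiv ℝ f x‖ ^ n / ENNReal.ofReal |(fderiv ℝ f x).det| := by
  have hJ := toEuclideanCLM_jacobianMatrix_eq_fderiv hf
  have hd : (jacobianMatrix f x).det = (fderiv ℝ f x).det := by rw [← hJ, det_toEuclideanCLM]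
  have hz : jacobianMatrix f x ≠ 0 := by
    intro hz
    rw [hz] at hJ
    exact h (hJ.symm.trans (map_zero _))
  have hpos : ENNReal.ofReal ‖fderiv ℝ f x‖ ^ n ≠ 0 := by
    refine pow_ne_zero n ?_
    rw [ne_eq, ENNReal.ofReal_eq_zero, not_le]
    exact norm_pos_iff.2 h
  rw [outerDil, if_pos (hasPartials_of_differentiableAt hf), hJ, hd]
  split_ifs with h0
  · rw [ENNReal.ofReal_div_of_pos (abs_pos.2 h0), ENNReal.ofReal_pow (norm_nonneg _)]
  · rw [not_not.1 h0, abs_zero, ENNReal.ofReal_zero, ENNReal.div_zero hpos]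

/-- Near `x₀`, the maps `F j` are eventually uniformly close to the affine approximation of their
limit at the scale of small cubes. -/
theorem eventually_forall_mem_cube_norm_le (hn : n ≠ 0) {D : Set (EuclideanSpace ℝ (Fin n))}
    (hDo : IsOpen D) {F : ℕ → EuclideanSpace ℝ (Fin n) → EuclideanSpace ℝ (Fin n)}
    {f : EuclideanSpace ℝ (Fin n) → EuclideanSpace ℝ (Fin n)}
    (hlim : TendstoLocallyUniformlyOn F f atTop D)
    {x₀ : EuclideanSpace ℝ (Fin n)} (hx₀ : x₀ ∈ D) (hdiff : DifferentiableAt ℝ f x₀)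
    (e : OrthonormalBasis (Fin n) ℝ (EuclideanSpace ℝ (Fin n))) {ε : ℝ} (hε : 0 < ε) :
    ∀ᶠ h : ℝ in 𝓝[>] 0, Metric.closedBall x₀ (n * (h / 2)) ⊆ D ∧ ∀ᶠ j in atTop,
      ∀ x ∈ cube e x₀ h, ‖F j x - f x₀ - fderiv ℝ f x₀ (x - x₀)‖ ≤ ε * h := by
  have hn0 : (0 : ℝ) < n := by exact_mod_cast Nat.pos_of_ne_zero hn
  obtain ⟨r₁, hr₁, hr₁D⟩ := Metric.isOpen_iff.1 hDo x₀ hx₀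
  -- Points of the cube are within `n * (h / 2)` of `x₀`, so slope `ε / n` costs `ε * h / 2`;
  -- uniform convergence takes the other half.
  have hlo := (hasFDerivAt_iff_isLittleO.1 hdiff.hasFDerivAt).def (div_pos hε hn0)
  obtain ⟨r₂, hr₂, hr₂f⟩ := Metric.eventually_nhds_iff.1 hlo
  have hr : 0 < min r₁ r₂ / n := by positivity
  filter_upwards [Ioo_mem_nhdsGT hr] with h hh
  have hh0 : 0 < h := hh.1
  have hhr : n * (h / 2) < min r₁ r₂ := by
    have := hh.2
    rw [lt_div_iff₀ hn0] at this
    nlinarith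
  have hball : Metric.closedBall x₀ (n * (h / 2)) ⊆ D :=
    (Metric.closedBall_subset_ball (hhr.trans_le (min_le_left _ _))).trans hr₁D
  refine ⟨hball, ?_⟩
  have hunif := (tendstoLocallyUniformlyOn_iff_forall_isCompact hDo).1 hlim _ hball
    (isCompact_closedBall x₀ (n * (h / 2)))
  filter_upwards [Metric.tendstoUniformlyOn_iff.1 hunif (ε * h / 2) (by positivity)] with j hj x hx
  have hxK := cube_subset_closedBall e x₀ h hx
  have h1 := hj x hxK
  rw [dist_comm, dist_eq_norm] at h1
  have h2 := hr₂f ((Metric.mem_closedBall.1 hxK).trans_lt (hhr.trans_le (min_le_right _ _)))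
  have h3 : ε / n * ‖x - x₀‖ ≤ ε * h / 2 := by
    calc ε / n * ‖x - x₀‖ ≤ ε / n * (n * (h / 2)) := by
          gcongr; exact mem_closedBall_iff_norm.1 hxK
      _ = ε * h / 2 := by field_simp
  have hid : F j x - f x₀ - fderiv ℝ f x₀ (x - x₀) =
      (F j x - f x) + (f x - f x₀ - fderiv ℝ f x₀ (x - x₀)) := by abel
  rw [hid]
  calc _ ≤ ‖F j x - f x‖ + ‖f x - f x₀ - fderiv ℝ f x₀ (x - x₀)‖ := norm_add_le _ _
    _ ≤ ε * h / 2 + ε * h / 2 := add_le_add h1.le (h2.trans h3)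
    _ = ε * h := by ring

theorem dilP_le_lowerCubeLimit (hn : 2 ≤ n)
    {D : Set (EuclideanSpace ℝ (Fin n))} (hDo : IsOpen D)
    {F : ℕ → EuclideanSpace ℝ (Fin n) → EuclideanSpace ℝ (Fin n)}
    {f : EuclideanSpace ℝ (Fin n) → EuclideanSpace ℝ (Fin n)}
    (hFcont : ∀ j, ContinuousOn (F j) D) (hFinj : ∀ j, InjOn (F j) D)
    (hFsob : ∀ j, MemW11loc D (F j))
    (hlim : TendstoLocallyUniformlyOn F f atTop D)
    {x₀ : EuclideanSpace ℝ (Fin n)} (hx₀ : x₀ ∈ D) (hdiff : DifferentiableAt ℝ f x₀)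
    {e : OrthonormalBasis (Fin n) ℝ (EuclideanSpace ℝ (Fin n))}
    (he : IsPrincipalAxes (fderiv ℝ f x₀) e) :
    dilP f x₀ ≤ lowerCubeLimit e x₀ (fun j => dilP (F j)) := by
  have hn0 : n ≠ 0 := by omega
  set A := fderiv ℝ f x₀ with hA
  by_cases hA0 : A = 0
  · rw [dilP, outerDil_of_fderiv_eq_zero hn0 hdiff hA0, ENNReal.one_rpow]
    exact const_le_lowerCubeLimit fun j y => one_le_dilP hn _ _
  obtain ⟨i, hi⟩ := he.exists_norm_eq hn0
  -- The cube is closed so that its image is compact and the volumes of the thickenings converge to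
  -- that of the image.
  set Q := {y | ∀ i, inner ℝ (e i) (y - 0) ∈ Icc (-(1 / 2) : ℝ) (1 / 2)} with hQ
  have hQc : IsCompact Q := by
    refine Metric.isCompact_of_isClosed_isBounded ?_ ?_
    · simp only [hQ, ofPred_forall]
      exact isClosed_iInter fun i =>
        isClosed_Icc.preimage (f := fun y => inner ℝ (e i) (y - 0)) (by fun_prop)
    · refine Metric.isBounded_closedBall.subset (t := Metric.closedBall 0 (n * (1 / 2 : ℝ)))
        fun y hy => ?_
      rw [mem_closedBall_zero_iff]
      exact norm_le_of_forall_abs_inner_le e fun k => abs_le.2 (by simpa using hy k)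
  have hQv : volume Q = 1 := by
    rw [hQ, volume_forall_inner_mem e 0 fun i => measurableSet_Icc]
    norm_num
  set V : ℝ → ℝ≥0∞ := fun ε => volume (Metric.cthickening ε (A '' Q)) with hV
  have hVlim : Tendsto V (𝓝[>] 0) (𝓝 (ENNReal.ofReal |A.det|)) := by
    have := tendsto_measure_cthickening_of_isCompact (μ := volume) (hQc.image A.continuous)
    rw [Measure.addHaar_image_continuousLinearMap, hQv, mul_one] at this
    exact this.mono_left nhdsWithin_le_nhds
  have hcpow : ENNReal.ofReal ‖A‖ ^ n ≠ 0 := pow_ne_zero n (by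
    rw [ne_eq, ENNReal.ofReal_eq_zero, not_le]
    exact norm_pos_iff.2 hA0)
  have hcpow' : ENNReal.ofReal ‖A‖ ^ n ≠ ∞ := ENNReal.pow_ne_top ENNReal.ofReal_ne_top
  have hclim : Tendsto (fun ε : ℝ => ENNReal.ofReal (‖A (e i)‖ * (1 - ε) - 2 * ε) ^ n) (𝓝[>] 0)
      (𝓝 (ENNReal.ofReal ‖A‖ ^ n)) := by
    have h1 : Continuous fun ε : ℝ => ENNReal.ofReal (‖A (e i)‖ * (1 - ε) - 2 * ε) ^ n :=
      (ENNReal.continuous_pow n).comp (ENNReal.continuous_ofReal.comp (by fun_prop))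
    have h2 := (h1.tendsto 0).mono_left (nhdsWithin_le_nhds (s := Ioi 0))
    simpa [hi] using h2
  -- The limit of the numerators is nonzero and finite, so the quotient converges even when `det A =
  -- 0`.
  have hlimit : Tendsto (fun ε : ℝ =>
      (ENNReal.ofReal (‖A (e i)‖ * (1 - ε) - 2 * ε) ^ n / V ε) ^ (1 / ((n : ℝ) - 1))) (𝓝[>] 0)
      (𝓝 (dilP f x₀)) := by
    rw [dilP, outerDil_of_fderiv_ne_zero hdiff hA0]
    exact (ENNReal.continuous_rpow_const.tendsto _).comp
      (ENNReal.Tendsto.div hclim (Or.inl hcpow) hVlim (Or.inr hcpow'))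
  refine le_of_tendsto hlimit ?_
  filter_upwards [Ioo_mem_nhdsGT (zero_lt_one (α := ℝ))] with ε hε
  refine le_lowerCubeLimit ?_
  filter_upwards [self_mem_nhdsWithin,
    eventually_forall_mem_cube_norm_le hn0 hDo hlim hx₀ hdiff e hε.1] with h hh hev
  filter_upwards [hev.2] with j hj
  exact (hFsob j).le_mean_dilP hn hDo (hFcont j) (hFinj j) hh hev.1 hε.1 hε.2 hj i
    (volume_image_cube_le hh hj)

end LowerSemicontinuity

/-! ### The theorem -/

theorem mainTheorem3 (n : ℕ) (hn : 2 ≤ n)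
    (D : Set (EuclideanSpace ℝ (Fin n))) (hDo : IsOpen D) (hDc : IsConnected D)
    (F : ℕ → EuclideanSpace ℝ (Fin n) → EuclideanSpace ℝ (Fin n))
    (f : EuclideanSpace ℝ (Fin n) → EuclideanSpace ℝ (Fin n))
    (hFhomeo : ∀ j, IsEmbedding (D.domRestrict (F j)))
    (hFsob : ∀ j, MemW11loc D (F j))
    (hlim : TendstoLocallyUniformlyOn F f atTop D)
    (x₀ : EuclideanSpace ℝ (Fin n)) (hx₀ : x₀ ∈ D) (hdiff : DifferentiableAt ℝ f x₀)
    (e : OrthonormalBasis (Fin n) ℝ (EuclideanSpace ℝ (Fin n)))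
    (he : IsPrincipalAxes (fderiv ℝ f x₀) e) :
    dilP f x₀ ≤ lowerCubeLimit e x₀ (fun j => dilP (F j)) ∧
    (∀ Φ : ℝ≥0∞ → ℝ≥0∞, ContinuousOn Φ (Icc 1 ⊤) → MonotoneOn Φ (Icc 1 ⊤) →
      ConvexOn ℝ≥0 (Icc 1 ⊤) Φ →
      Φ (dilP f x₀) ≤ lowerCubeLimit e x₀ (fun j y => Φ (dilP (F j) y))) ∧
    outerDil f x₀ ≤ lowerCubeLimit e x₀ (fun j => outerDil (F j)) := by
  have hmain := dilP_le_lowerCubeLimit hn hDo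
    (fun j => continuousOn_iff_continuous_domRestrict.2 (hFhomeo j).continuous)
    (fun j => injOn_iff_injective.2 (hFhomeo j).injective) hFsob hlim hx₀ hdiff he
  have hJensen : ∀ Φ : ℝ≥0∞ → ℝ≥0∞, ContinuousOn Φ (Icc 1 ⊤) → MonotoneOn Φ (Icc 1 ⊤) →
      ConvexOn ℝ≥0 (Icc 1 ⊤) Φ →
      Φ (dilP f x₀) ≤ lowerCubeLimit e x₀ (fun j y => Φ (dilP (F j) y)) :=
    fun Φ h1 h2 h3 => apply_le_lowerCubeLimit_comp (fun j y => one_le_dilP hn _ _)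
      (one_le_dilP hn _ _) hmain h1 h2 h3
  refine ⟨hmain, hJensen, ?_⟩
  have hpow := hJensen (fun t => t ^ (n - 1)) (ENNReal.continuous_pow _).continuousOn
    (fun _ _ _ _ h => pow_le_pow_left' h _) (convexOn_ennreal_pow _ (by omega))
  simpa only [dilP_pow hn] using hpow
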